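/- **Setting.** Let $\mathcal S$ be a set of $n$ constraints, each given by a string of $b=\mathrm{bit}(\mathcal S)$ bits, let $R$ be a totally ordered set and let $f$ assign an element of $R$ to every finite set of constraints. Suppose that $(\mathcal S,f)$ is an LP-type problem: for $X\subseteq Y\subseteq\mathcal S$ we have $f(X)\le f(Y)\le f(\mathcal S)$, and if moreover $e\in\mathcal S$ and $f(X)=f(Y)=f(X\cup\{e\})$, then $f(Y)=f(Y\cup\{e\})$. Suppose also (P1) that each constraint $X$ is associated with a set $S_X\subseteq R$, and (P2) that for every $\mathcal A\subseteq\mathcal S$ the value $f(\mathcal A)$ is the minimal element of $\bigcap_{X\in\mathcal A}S_X$. A *basis* of $\mathcal N\subseteq\mathcal S$ is a set $\mathcal B\subseteq\mathcal N$ with $f(\mathcal B)=f(\mathcal N)$ and $f(\mathcal B')<f(\mathcal B)$ for all $\mathcal B'\subsetneq\mathcal B$. The *combinatorial dimension* is the maximum cardinality of a basis of a subfamily of $\mathcal S$. The *VC dimension* of the problem is the maximum cardinality of a set $\mathcal C\subseteq\mathcal S$ every subset of which has the form $\{X\in\mathcal C: x\notin S_X\}$ for some $x\in R$. A constraint $X$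 *violates* $\mathcal B$ if $f(\mathcal B\cup\{X\})>f(\mathcal B)$. **Model.** A randomized multi-pass streaming machine reads the constraints of $\mathcal S$ one by one, each once per pass, in an arbitrary order. It has registers of $w$ bits in all, and a number of memory slots, each holding a set of constraints. In one step it changes its registers, draws a random $w$-bit word, reads the next constraint, adds a constraint to a slot or empties a slot, puts a basis of the set in one slot into another slot, or tests whether a constraint violates the set in a slot. It has no other access to $f$. Its answer is $f(\mathcal A)$, where $\mathcal A$ is the set in its output slot. The space is $w$ bits plus $b$ bits for each slot and each stored constraint. Each step costs one unit of time; in addition, computing a basis of $m$ constraints costs $T_b(m)$, and $t\ge1$ violation tests against the same stored set of $m$ constraints (while it stays in its slot) cost $T_v(t,m)$ altogether. Here $T_b$ and $T_v$ are nondecreasing (in each argument), and $T_v(t,m)\ge t$. **Theorem.** For every real $c\ge 1$ there are constants $C,k\in\mathbb N$ such that for all integers $n$, $\nu\ge1$, $\lambda\ge 0$, $b\ge 0$ and $1\le r\le\ln n$ there is such a machine, depending only on these parameters and with registers of at most $C\,b$ bits, with the following property. For every problem $(\mathcal S,f)$ as above with $n$ constraints of $b$ bits, combinatorial dimension at most $\nu$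 and VC dimension at most $\lambda$, for every order of the stream, every basis procedure and all $T_v,T_b$ as above, the machine answers $f(\mathcal S)$ with probability at least $1-n^{-c}$, and it always halts after using * at most $C\,\nu r$ passes, * at most $C\,(\lambda\nu n^{1/r}+\nu^2)\,(\ln n)^k\cdot b$ bits of space, that is, $\widetilde O(\lambda\nu n^{1/r}+\nu^2)\cdot\mathrm{bit}(\mathcal S)$, * total running time at most $C\,\bigl(\nu r\,T_v(n,\nu)+\nu r\,T_b(m)\bigr)$, where $m=\lceil C\,\lambda\nu n^{1/r}(\ln n)^k\rceil=\widetilde O(\lambda\nu n^{1/r})$. -/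

import Mathlib

/-! ### LP-type problems -/

/-- `(S, f)` is an LP-type problem: `f` is monotone and local on the subsets of `S`. -/
structure IsLPType {U R : Type*} [DecidableEq U] [LinearOrder R]
    (f : Finset U → R) (S : Finset U) : Prop where
  monotone : ∀ X Y : Finset U, X ⊆ Y → Y ⊆ S → f X ≤ f Y ∧ f Y ≤ f S
  locality : ∀ X Y : Finset U, X ⊆ Y → Y ⊆ S → ∀ e ∈ S,
    f X = f Y → f X = f (insert e X) → f Y = f (insert e Y)

/-- Each constraint `X` is associated with a set `K X` of elements of the range, and the value
of every subfamily `A` of `S` is the minimal element of the intersection of its sets. -/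
def IsMinOfInter {U R : Type*} [LinearOrder R]
    (f : Finset U → R) (S : Finset U) (K : U → Set R) : Prop :=
  ∀ A : Finset U, A ⊆ S → IsLeast (⋂ X ∈ A, K X) (f A)

/-- `B` is a basis of `N`. -/
def IsBasis {U R : Type*} [LinearOrder R] (f : Finset U → R) (N B : Finset U) : Prop :=
  B ⊆ N ∧ f B = f N ∧ ∀ B' : Finset U, B' ⊂ B → f B' < f B

open Classical in
/-- The combinatorial dimension: the largest cardinality of a basis (of a subfamily of `S`). -/
noncomputable def combDim {U R : Type*} [LinearOrder R]
    (f : Finset U → R) (S : Finset U) : ℕ :=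
  (S.powerset.filter fun B => ∃ N ⊆ S, IsBasis f N B).sup Finset.card

open Classical in
/-- The family of all sets `{X ∈ S | x ∉ K X}` of constraints that exclude a point `x`. -/
noncomputable def exclusionFamily {U R : Type*}
    (S : Finset U) (K : U → Set R) : Finset (Finset U) :=
  S.powerset.filter fun V => ∃ x : R, ∀ X ∈ S, X ∈ V ↔ x ∉ K X

/-- The VC dimension of the problem: the largest number of constraints of `S` all of whose
subsets are cut out by the exclusion sets `{X ∈ S | x ∉ K X}` of points `x`. -/
noncomputable def problemVCDim {U R : Type*} [DecidableEq U]
    (S : Finset U) (K : U → Set R) : ℕ :=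
  (exclusionFamily S K).vcDim

/-! ### Multi-pass streaming machines

A machine has a control state (its registers, `w` bits in all) and `slots` memory slots, each
holding a finite set of constraints. It sees the input only as a read-only stream, and has no
access to the function `f` other than through violation tests and basis computations. -/

/-- A constraint is given by a string of `b` bits. -/
abbrev Constraint (b : ℕ) : Type := Fin b → Bool

/-- The instructions of a machine with `w` bits of registers, `s` slots and control states `Q`. -/
inductive Instr (b w s : ℕ) (Q : Type) : Type
  /-- stop; the answer is `f` of the set in slot `i` -/
  | halt (i : Fin s)
  /-- change the registers -/
  | goto (q : Q)
  /-- draw a uniformly random `w`-bit word -/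
  | random (k : Fin (2 ^ w) → Q)
  /-- read the next constraint of the stream, or `none` at its end, which rewinds the stream -/
  | read (k : Option (Constraint b) → Q)
  /-- add the constraint `x` to slot `i` -/
  | store (i : Fin s) (x : Constraint b) (q : Q)
  /-- empty slot `i` -/
  | clear (i : Fin s) (q : Q)
  /-- compute a basis of the set in slot `i` and put it into slot `j` -/
  | basis (i j : Fin s) (q : Q)
  /-- test whether the constraint `x` violates the set in slot `i` -/
  | test (i : Fin s) (x : Constraint b) (k : Bool → Q)

/-- A randomized streaming machine for constraints of `b` bits. -/
structure Machine (b : ℕ) where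
  /-- the number of bits of the registers -/
  w : ℕ
  /-- the number of memory slots -/
  slots : ℕ
  /-- the control states -/
  Q : Type
  /-- the control states form a finite type -/
  fintypeQ : Fintype Q
  /-- a control state fits into the registers -/
  card_le : Fintype.card Q ≤ 2 ^ w
  /-- the initial control state -/
  start : Q
  /-- the program -/
  instr : Q → Instr b w slots Q

/-- A configuration of a machine, together with the resources used so far. -/
structure Config {b : ℕ} (M : Machine b) where
  /-- the control state -/
  q : M.Q
  /-- the contents of the slots -/
  mem : Fin M.slots → Finset (Constraint b)
  /-- the number of tests against each slot since it was last written -/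
  tests : Fin M.slots → ℕ
  /-- the position in the stream -/
  pos : ℕ
  /-- the number of passes begun so far -/
  passes : ℕ
  /-- the running time so far -/
  time : ℕ
  /-- the largest space used so far, in bits -/
  peak : ℕ

namespace Config

variable {b : ℕ} {M : Machine b}

/-- The space in use, in bits: the registers, and `b` bits for each slot and for each stored
constraint. -/
def space (c : Config M) : ℕ :=
  M.w + b * (M.slots + ∑ i, (c.mem i).card)

/-- Overwrite slot `i`. -/
def write (c : Config M) (i : Fin M.slots) (A : Finset (Constraint b)) : Config M :=
  { c with mem := Function.update c.mem i A, tests := Function.update c.tests i 0 }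

/-- Go to control state `q`, spend `t` units of time, and update the space record. -/
def next (c : Config M) (q : M.Q) (t : ℕ) : Config M :=
  { c with q := q, time := c.time + t, peak := max c.peak c.space }

end Config

/-- The cost of one more test against a stored set of size `m`, after `t` tests against it, so
that `t ≥ 1` tests against the same stored set have the total cost `Tv t m`. -/
def testCost (Tv : ℕ → ℕ → ℕ) (t m : ℕ) : ℕ :=
  if t = 0 then Tv 1 m else Tv (t + 1) m - Tv t m

namespace Machine

variable {b : ℕ} (M : Machine b)

/-- The initial configuration. -/
def init : Config M where
  q := M.start
  mem := fun _ => ∅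
  tests := fun _ => 0
  pos := 0
  passes := 0
  time := 0
  peak := M.w + b * M.slots

/-- One step on the input `stream`. Violation is decided by `f`, and `bas` is the procedure that
computes bases. Every instruction takes one unit of time; a basis computation for `m` constraints
costs `Tb m` in addition, and `t` tests against the same set of `m` constraints cost `Tv t m`. -/
noncomputable def step {R : Type*} [LinearOrder R] (f : Finset (Constraint b) → R)
    (bas : Finset (Constraint b) → Finset (Constraint b))
    (Tv : ℕ → ℕ → ℕ) (Tb : ℕ → ℕ) {n : ℕ} (stream : Fin n → Constraint b)
    (c : Config M) : PMF (Config M) :=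
  match M.instr c.q with
  | .halt _ => PMF.pure c
  | .goto q => PMF.pure (c.next q 1)
  | .random k => (PMF.uniformOfFintype (Fin (2 ^ M.w))).map fun z => c.next (k z) 1
  | .read k =>
      if h : c.pos < n then
        PMF.pure (Config.next
          { c with
            pos := c.pos + 1
            passes := if c.pos = 0 then c.passes + 1 else c.passes }
          (k (some (stream ⟨c.pos, h⟩))) 1)
      else
        PMF.pure (Config.next { c with pos := 0 } (k none) 1)
  | .store i x q => PMF.pure ((c.write i (insert x (c.mem i))).next q 1)
  | .clear i q => PMF.pure ((c.write i ∅).next q 1)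
  | .basis i j q => PMF.pure ((c.write j (bas (c.mem i))).next q (1 + Tb (c.mem i).card))
  | .test i x k =>
      PMF.pure (Config.next
        { c with tests := Function.update c.tests i (c.tests i + 1) }
        (k (decide (f (c.mem i) < f (insert x (c.mem i)))))
        (1 + testCost Tv (c.tests i) (c.mem i).card))

/-- The random configuration after `T` steps. -/
noncomputable def run {R : Type*} [LinearOrder R] (f : Finset (Constraint b) → R)
    (bas : Finset (Constraint b) → Finset (Constraint b))
    (Tv : ℕ → ℕ → ℕ) (Tb : ℕ → ℕ) {n : ℕ} (stream : Fin n → Constraint b) :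
    ℕ → PMF (Config M)
  | 0 => PMF.pure M.init
  | T + 1 => (run f bas Tv Tb stream T).bind (M.step f bas Tv Tb stream)

end Machine

/-- The configuration has halted with the set `A` in its output slot. -/
def Config.Outputs {b : ℕ} {M : Machine b} (c : Config M) (A : Finset (Constraint b)) : Prop :=
  ∃ i, M.instr c.q = .halt i ∧ c.mem i = A

/-! The machine reweights constraints in the manner of Clarkson, but keeps one growing sample. Every
constraint is hit in pass 0, and later whenever it violates the basis of the current pass. A
constraint with `l` earlier hits is then sampled with probability about `q β^l / n` (at most 1),
where `β = ⌈n^(1/r)⌉`; the sum of these rates is its `load`. Before each of the passes `1, …, T`,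
with `T = 2νr`, a basis of the sample is stored. The number of earlier hits is not remembered but
recomputed, by testing against the stored bases.

Deterministic part. A pass is heavy if the constraints hit in it have total load above `n / (Tβ)`. A
later hit raises a load by at most `β` times its old value, so a pass that is not heavy adds at most
`n / T`, and without heavy passes the total load stays at most `2n` (`sum_load_level_le`). If all
stored bases had value below `f S`, every pass would hit an element of a fixed basis of `S`, which
has at most `ν` elements. One of them would be hit more than `2r` times and have load at least
`β^(2r) ≥ n² > 2n` (`exists_eq_of_not_heavy`). So some stored basis has value `f S`, and so has the
final sample, which contains the sample it was computed from.

Probabilistic part. By (P2) the violators of a set `A` are the constraints whose sets exclude the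
point `f A`. Hence they form one of at most `(n+1)^λ` exclusion sets (Sauer–Shelah), and the
violators of a basis of the sample avoid the sample. Loads depend on earlier random choices, so a
union bound over a fixed distribution is not available. Instead, `potential` sums `exp (q · load V /
n)` over the exclusion sets `V` that the sample misses, and adds a term that controls the sample
size. It does not increase on average (`potential_sample_le`), and it is frozen at a threshold `Θ`
once a pass is heavy. Every failure (a wrong answer, or an overflow of the counters for hits or
samples) forces it to be at least `Θ`, and Markov's inequality concludes (`Setting.run_steps`).

Running time. A rank decreases with each step. Tests against old bases are charged to hits, of which
there are at most `2n`. -/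

/-! ### Violation in terms of (P2) -/

theorem violates_iff {U R : Type*} [DecidableEq U] [LinearOrder R] {f : Finset U → R}
    {S A : Finset U} {K : U → Set R} (hK : IsMinOfInter f S K) (hA : A ⊆ S) {e : U} (he : e ∈ S) :
    f A < f (insert e A) ↔ f A ∉ K e := by
  have h1 := hK A hA
  have h2 := hK (insert e A) (Finset.insert_subset he hA)
  constructor
  · intro hlt hmem
    refine absurd (h2.2 ?_) (not_le.2 hlt)
    have := h1.1
    simp only [Set.mem_iInter, Finset.mem_insert] at this ⊢
    rintro X (rfl | hX)
    · exact hmem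
    · exact this X hX
  · intro hn
    have h3 := h2.1
    simp only [Set.mem_iInter, Finset.mem_insert] at h3
    refine lt_of_le_of_ne (h1.2 ?_) fun h => hn (h ▸ h3 e (Or.inl rfl))
    simp only [Set.mem_iInter]
    exact fun X hX => h3 X (Or.inr hX)

theorem IsMinOfInter.mono {U R : Type*} [LinearOrder R] {f : Finset U → R}
    {S A A' : Finset U} {K : U → Set R} (hK : IsMinOfInter f S K) (h : A ⊆ A') (h' : A' ⊆ S) :
    f A ≤ f A' := by
  refine (hK A (h.trans h')).2 ?_
  have := (hK A' h').1
  simp only [Set.mem_iInter] at this ⊢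
  exact fun X hX => this X (h hX)

theorem not_violates_of_mem {U R : Type*} [DecidableEq U] [LinearOrder R] {f : Finset U → R}
    {S A N : Finset U} {K : U → Set R} (hK : IsMinOfInter f S K) (hA : A ⊆ S) (hN : N ⊆ S)
    (h : f A = f N) {e : U} (he : e ∈ N) : ¬ f A < f (insert e A) := by
  rw [violates_iff hK hA (hN he), not_not, h]
  have := (hK N hN).1
  simp only [Set.mem_iInter] at this
  exact this e he

/-- If nothing in `N` violates `A`, then `f A` lies in the intersection over `N`, whose minimum is
`f N`. This is why an unsuccessful pass must hit every basis of `S`. -/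
theorem exists_violator {U R : Type*} [DecidableEq U] [LinearOrder R] {f : Finset U → R}
    {S A N : Finset U} {K : U → Set R} (hK : IsMinOfInter f S K) (hA : A ⊆ S) (hN : N ⊆ S)
    (h : f A < f N) : ∃ e ∈ N, f A < f (insert e A) := by
  by_contra! hcon
  refine absurd ((hK N hN).2 ?_) (not_le.2 h)
  simp only [Set.mem_iInter]
  intro X hX
  by_contra hn
  exact absurd ((violates_iff hK hA (hN hX)).2 hn) (not_lt.2 (hcon X hX))

-- The point that cuts out the violators of `A` is `f A`. This is the only place where violation
-- meets the VC dimension.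
open Classical in
theorem filter_violates_mem_exclusionFamily {U R : Type*} [DecidableEq U] [LinearOrder R]
    {f : Finset U → R} {S A : Finset U} {K : U → Set R} (hK : IsMinOfInter f S K) (hA : A ⊆ S) :
    (S.filter fun e => f A < f (insert e A)) ∈ exclusionFamily S K := by
  rw [exclusionFamily, Finset.mem_filter]
  refine ⟨by simp, f A, fun X hX => ?_⟩
  rw [Finset.mem_filter, and_iff_right hX, ← violates_iff hK hA hX]

theorem subset_of_mem_exclusionFamily {U R : Type*} {S V : Finset U} {K : U → Set R}
    (h : V ∈ exclusionFamily S K) : V ⊆ S := by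
  classical
  rw [exclusionFamily, Finset.mem_filter, Finset.mem_powerset] at h
  exact h.1

theorem IsBasis.card_le_combDim {U R : Type*} [LinearOrder R] {f : Finset U → R}
    {S N B : Finset U} (h : IsBasis f N B) (hN : N ⊆ S) : B.card ≤ combDim f S := by
  classical
  exact Finset.le_sup (f := Finset.card)
    (Finset.mem_filter.2 ⟨Finset.mem_powerset.2 (h.1.trans hN), N, hN, h⟩)

theorem combDim_le_card {U R : Type*} [LinearOrder R] (f : Finset U → R) (S : Finset U) :
    combDim f S ≤ S.card := by
  classical
  refine Finset.sup_le fun B hB => Finset.card_le_card ?_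
  exact Finset.mem_powerset.1 (Finset.mem_filter.1 hB).1

theorem subset_of_shatters_exclusionFamily {U R : Type*} [DecidableEq U] {S V : Finset U}
    {K : U → Set R} (h : (exclusionFamily S K).Shatters V) : V ⊆ S := by
  obtain ⟨u, hu, hVu⟩ := h (Finset.Subset.refl V)
  exact (Finset.inter_eq_left.1 hVu).trans (subset_of_mem_exclusionFamily hu)

theorem problemVCDim_le_card {U R : Type*} [DecidableEq U] (S : Finset U) (K : U → Set R) :
    problemVCDim S K ≤ S.card := by
  refine Finset.sup_le fun V hV => Finset.card_le_card ?_
  exact subset_of_shatters_exclusionFamily (Finset.mem_shatterer.1 hV)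

/-! ### Counting exclusion sets -/

theorem card_powerset_filter_card_le {U : Type*} (S : Finset U) (d : ℕ) :
    (S.powerset.filter fun V => V.card ≤ d).card ≤ (S.card + 1) ^ d := by
  classical
  have hsub : (S.powerset.filter fun V => V.card ≤ d) ⊆
      (Finset.range (d + 1)).biUnion fun k => S.powersetCard k := by
    intro V hV
    simp only [Finset.mem_filter, Finset.mem_powerset] at hV
    simp only [Finset.mem_biUnion, Finset.mem_range, Finset.mem_powersetCard]
    exact ⟨V.card, by omega, hV.1, rfl⟩
  refine (Finset.card_le_card hsub).trans (Finset.card_biUnion_le.trans ?_)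
  -- Term by term, `S.card.choose k ≤ S.card ^ k`, and the binomial expansion of `(S.card + 1) ^ d`
  -- contains `S.card ^ k` with a positive coefficient.
  rw [add_pow]
  refine Finset.sum_le_sum fun k hk => ?_
  rw [Finset.card_powersetCard, one_pow, mul_one]
  have hc : 0 < d.choose k := Nat.choose_pos (by simp at hk; omega)
  calc S.card.choose k ≤ S.card ^ k := Nat.choose_le_pow _ _
    _ ≤ S.card ^ k * d.choose k := Nat.le_mul_of_pos_right _ hc

/-- The Sauer–Shelah bound for the exclusion sets. -/
theorem card_exclusionFamily_le {U R : Type*} [DecidableEq U] (S : Finset U) (K : U → Set R) :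
    (exclusionFamily S K).card ≤ (S.card + 1) ^ problemVCDim S K := by
  refine (Finset.card_le_card_shatterer _).trans
    ((Finset.card_le_card ?_).trans (card_powerset_filter_card_le S _))
  intro V hV
  rw [Finset.mem_filter, Finset.mem_powerset]
  have h := Finset.mem_shatterer.1 hV
  exact ⟨subset_of_shatters_exclusionFamily h, h.card_le_vcDim⟩

/-- With a single exclusion set, `∅` and `S` have the same violators, and `S` has none. The case
needs its own argument because the allowed sample size has the factor `λ`. -/
theorem IsMinOfInter.eq_of_problemVCDim_eq_zero {U R : Type*} [DecidableEq U] [LinearOrder R]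
    {f : Finset U → R} {S : Finset U} {K : U → Set R} (hK : IsMinOfInter f S K)
    (h : problemVCDim S K = 0) : f ∅ = f S := by
  refine le_antisymm (hK.mono (Finset.empty_subset S) subset_rfl) (not_lt.1 fun hlt => ?_)
  have hcard : (exclusionFamily S K).card ≤ 1 := by
    simpa [h] using card_exclusionFamily_le S K
  obtain ⟨e, he, hv⟩ := exists_violator hK (Finset.empty_subset S) subset_rfl hlt
  have h1 := filter_violates_mem_exclusionFamily hK (Finset.empty_subset S)
  have h2 := filter_violates_mem_exclusionFamily hK (subset_refl S)
  have := Finset.card_le_one.1 hcard _ h1 _ h2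
  have hm : e ∈ S.filter fun e => f ∅ < f (insert e ∅) := Finset.mem_filter.2 ⟨he, hv⟩
  classical
  have hm' : e ∈ S.filter fun e => f S < f (insert e S) := by
    convert hm using 1
    convert this.symm
  rw [Finset.mem_filter, Finset.insert_eq_of_mem he] at hm'
  exact lt_irrefl _ hm'.2

/-- Hence computing a basis of a stored basis in place leaves the slot unchanged; its only effect is
to reset the count of tests. -/
theorem IsBasis.basis_eq_self {U R : Type*} [LinearOrder R] {f : Finset U → R}
    {N B B' : Finset U} (h : IsBasis f N B) (h' : IsBasis f B B') : B' = B := by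
  by_contra hne
  exact (h.2.2 B' (lt_of_le_of_ne h'.1 hne)).ne h'.2.1

/-! ### Levels and loads -/

section Levels

variable {U R : Type*} [DecidableEq U] [LinearOrder R] (f : Finset U → R) (B : ℕ → Finset U)

/-- The constraint `e` is hit in pass `s`: everything is hit in pass `0`, and later the
constraints that violate the set `B s`. -/
def Hit (s : ℕ) (e : U) : Prop := s = 0 ∨ f (B s) < f (insert e (B s))

open Classical in
/-- The number of passes before pass `t` in which `e` is hit. -/
noncomputable def level (t : ℕ) (e : U) : ℕ := ((Finset.range t).filter fun s => Hit f B s e).card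

open Classical in
/-- The number of hits of `e` during pass `t`, when the constraints in `D` have been read. -/
noncomputable def midLevel (t : ℕ) (D : Finset U) (e : U) : ℕ :=
  level f B t e + if e ∈ D ∧ Hit f B t e then 1 else 0

/-- The total sampling rate of a constraint that has been hit `l` times. -/
def load (β l : ℕ) : ℕ := ∑ j ∈ Finset.range l, β ^ j

open Classical in
/-- The constraints hit in pass `s` have a large load. -/
def Heavy (S : Finset U) (T β s : ℕ) : Prop :=
  S.card < T * β * ∑ e ∈ S.filter (Hit f B s), load β (level f B s e)

variable {f B}

theorem level_succ (t : ℕ) (e : U) [Decidable (Hit f B t e)] :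
    level f B (t + 1) e = level f B t e + if Hit f B t e then 1 else 0 := by
  classical
  unfold level
  rw [Finset.range_add_one, Finset.filter_insert]
  split_ifs <;> simp

theorem midLevel_of_not_mem {t : ℕ} {D : Finset U} {e : U} (h : e ∉ D) :
    midLevel f B t D e = level f B t e := by
  simp [midLevel, h]

theorem midLevel_of_mem {t : ℕ} {D : Finset U} {e : U} (h : e ∈ D) :
    midLevel f B t D e = level f B (t + 1) e := by
  classical
  simp [midLevel, h, level_succ]

theorem midLevel_le (t : ℕ) (D : Finset U) (e : U) :
    midLevel f B t D e ≤ level f B (t + 1) e := by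
  classical
  rw [midLevel, level_succ]
  split_ifs <;> simp_all

theorem midLevel_insert_of_hit {t : ℕ} {D : Finset U} {x : U} (hx : x ∉ D) (h : Hit f B t x)
    (e : U) :
    midLevel f B t (insert x D) e = midLevel f B t D e + if e = x then 1 else 0 := by
  classical
  by_cases he : e = x
  · subst he; simp [midLevel, hx, h]
  · simp [midLevel, he]

theorem midLevel_insert_of_not_hit {t : ℕ} {D : Finset U} {x : U} (h : ¬ Hit f B t x) (e : U) :
    midLevel f B t (insert x D) e = midLevel f B t D e := by
  classical
  by_cases he : e = x
  · subst he; simp [midLevel, h]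
  · simp [midLevel, he]

theorem hit_congr {B' : ℕ → Finset U} {s : ℕ} (h : s ≠ 0 → B s = B' s) (e : U) :
    Hit f B s e ↔ Hit f B' s e := by
  unfold Hit
  by_cases hs : s = 0
  · simp [hs]
  · rw [h hs]

theorem level_congr {B' : ℕ → Finset U} {t : ℕ} (h : ∀ s, s < t → s ≠ 0 → B s = B' s) (e : U) :
    level f B t e = level f B' t e := by
  classical
  unfold level
  congr 1
  exact Finset.filter_congr fun s hs => hit_congr (h s (Finset.mem_range.1 hs)) e

theorem midLevel_congr {B' : ℕ → Finset U} {t : ℕ} (D : Finset U)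
    (h : ∀ s, s ≤ t → s ≠ 0 → B s = B' s) (e : U) :
    midLevel f B t D e = midLevel f B' t D e := by
  classical
  unfold midLevel
  rw [level_congr fun s hs => h s hs.le]
  simp only [hit_congr (h t le_rfl) e]

theorem heavy_congr {B' : ℕ → Finset U} {S : Finset U} {T β t : ℕ}
    (h : ∀ s, s ≤ t → s ≠ 0 → B s = B' s) : Heavy f B S T β t ↔ Heavy f B' S T β t := by
  classical
  unfold Heavy
  have h1 : S.filter (Hit f B t) = S.filter (Hit f B' t) :=
    Finset.filter_congr fun e _ => hit_congr (h t le_rfl) e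
  rw [h1]
  simp only [level_congr fun s hs => h s hs.le]

theorem level_pos {t : ℕ} (ht : 0 < t) (e : U) : 0 < level f B t e := by
  classical
  exact Finset.card_pos.2 ⟨0, Finset.mem_filter.2 ⟨Finset.mem_range.2 ht, Or.inl rfl⟩⟩

theorem level_le (t : ℕ) (e : U) : level f B t e ≤ t := by
  classical
  exact (Finset.card_filter_le _ _).trans (Finset.card_range t).le

theorem load_succ (β l : ℕ) : load β (l + 1) = load β l + β ^ l := Finset.sum_range_succ _ _

theorem load_mono (β : ℕ) : Monotone (load β) := fun _ _ h =>
  Finset.sum_le_sum_of_subset (Finset.range_mono h)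

theorem le_load {β : ℕ} (hβ : 1 ≤ β) (l : ℕ) : l ≤ load β l := by
  calc l = ∑ j ∈ Finset.range l, 1 := by simp
    _ ≤ load β l := Finset.sum_le_sum fun j _ => Nat.one_le_pow _ _ hβ

/-- The last term of the load is `β ^ (l - 1)`. A further hit thus adds at most `β` times the
present load, which explains the factor `β` in `Heavy`. -/
theorem pow_le_mul_load (β : ℕ) {l : ℕ} (hl : 0 < l) : β ^ l ≤ β * load β l := by
  obtain ⟨k, rfl⟩ : ∃ k, l = k + 1 := ⟨l - 1, by omega⟩
  rw [load_succ, pow_succ']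
  exact Nat.mul_le_mul_left _ (Nat.le_add_left _ _)

/-- Pass 0 gives every constraint load 1, and each later pass that is not heavy adds at most `S.card
/ T` in total. -/
theorem sum_load_level_le {S : Finset U} {T β : ℕ} :
    ∀ t, (∀ s, 1 ≤ s → s ≤ t → ¬ Heavy f B S T β s) →
      T * ∑ e ∈ S, load β (level f B (t + 1) e) ≤ (T + t) * S.card := by
  classical
  intro t
  induction t with
  | zero =>
    intro _
    have : ∀ e, level f B (0 + 1) e = 1 := fun e => by
      have h1 := level_pos (f := f) (B := B) zero_lt_one e
      have h2 := level_le (f := f) (B := B) (0 + 1) e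
      rw [zero_add] at h2 ⊢
      omega
    simp [this, load]
  | succ t ih =>
    intro h
    have ih := ih fun s hs hst => h s hs (by omega)
    have hh := h (t + 1) (by omega) le_rfl
    rw [Heavy, not_lt] at hh
    have hstep : ∑ e ∈ S, load β (level f B (t + 1 + 1) e) ≤
        ∑ e ∈ S, load β (level f B (t + 1) e) +
          β * ∑ e ∈ S.filter (Hit f B (t + 1)), load β (level f B (t + 1) e) := by
      rw [Finset.sum_filter, Finset.mul_sum, ← Finset.sum_add_distrib]
      refine Finset.sum_le_sum fun e _ => ?_
      rw [level_succ (t + 1)]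
      split_ifs
      · rw [load_succ]
        exact Nat.add_le_add_left (pow_le_mul_load β (level_pos (Nat.succ_pos t) e)) _
      · simp
    calc _ ≤ T * (∑ e ∈ S, load β (level f B (t + 1) e) +
          β * ∑ e ∈ S.filter (Hit f B (t + 1)), load β (level f B (t + 1) e)) :=
            Nat.mul_le_mul_left _ hstep
      _ ≤ (T + t) * S.card + S.card := by
            rw [mul_add, ← mul_assoc]; exact Nat.add_le_add ih hh
      _ = _ := by ring

theorem sum_load_midLevel_le {S : Finset U} {T β t : ℕ} (hT : 0 < T) (ht : t ≤ T)
    (h : ∀ s, 1 ≤ s → s ≤ t → ¬ Heavy f B S T β s) (D : Finset U) :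
    ∑ e ∈ S, load β (midLevel f B t D e) ≤ 2 * S.card := by
  refine (Finset.sum_le_sum fun e _ => load_mono β (midLevel_le t D e)).trans ?_
  refine Nat.le_of_mul_le_mul_left ((sum_load_level_le t h).trans ?_) hT
  calc (T + t) * S.card ≤ (T + T) * S.card := Nat.mul_le_mul_right _ (by omega)
    _ = T * (2 * S.card) := by ring

/-- If no pass is heavy and there are enough passes, then one of the sets has the value of `S`. -/
theorem exists_eq_of_not_heavy {S N : Finset U} {K : U → Set R} (hK : IsMinOfInter f S K)
    {ν r β : ℕ} (hν : 1 ≤ ν) (hr : 1 ≤ r) (hβ : S.card ≤ β ^ r) (hS : 3 ≤ S.card)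
    (hN : N ⊆ S) (hNf : f N = f S) (hNc : N.card ≤ ν)
    (hB : ∀ s, 1 ≤ s → s ≤ ν * (2 * r) → B s ⊆ S)
    (h : ∀ s, 1 ≤ s → s ≤ ν * (2 * r) → ¬ Heavy f B S (ν * (2 * r)) β s) :
    ∃ s, 1 ≤ s ∧ s ≤ ν * (2 * r) ∧ f S ≤ f (B s) := by
  classical
  by_contra! hcon
  set T := ν * (2 * r) with hTdef
  have hT : 0 < T := by positivity
  -- Pass 0 hits all of `N`; every later pass hits at least one of its elements.
  have hcount : ∀ t, t ≤ T → N.card + t ≤ ∑ e ∈ N, level f B (t + 1) e := by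
    intro t
    induction t with
    | zero =>
      intro _
      calc N.card + 0 = ∑ e ∈ N, 1 := by simp
        _ ≤ _ := Finset.sum_le_sum fun e _ => level_pos (Nat.succ_pos 0) e
    | succ t ih =>
      intro ht
      obtain ⟨e, he, hv⟩ := exists_violator hK (hB (t + 1) (by omega) ht) hN
        (hNf ▸ hcon (t + 1) (by omega) ht)
      have hlt : ∑ e ∈ N, level f B (t + 1) e < ∑ e ∈ N, level f B (t + 1 + 1) e := by
        refine Finset.sum_lt_sum (fun e _ => ?_) ⟨e, he, ?_⟩
        · rw [level_succ (t + 1)]; omega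
        · have hhit : Hit f B (t + 1) e := Or.inr hv
          rw [level_succ (t + 1), if_pos hhit]; omega
      have := ih (by omega)
      omega
  -- Pigeonhole. The extra `N.card` from pass 0 makes the inequality strict unless `N` is empty, and
  -- then the count fails because `T > 0`.
  have hex : ∃ e ∈ N, 2 * r < level f B (T + 1) e := by
    by_contra! hle
    have h1 := hcount T le_rfl
    have h2 : ∑ e ∈ N, level f B (T + 1) e ≤ N.card * (2 * r) := by
      simpa using Finset.sum_le_sum hle
    have h3 : N.card * (2 * r) ≤ T := Nat.mul_le_mul_right _ hNc
    have hN0 : N.card = 0 := by omega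
    rw [hN0] at h1 h2
    omega
  obtain ⟨e, he, hlev⟩ := hex
  have h1 : load β (level f B (T + 1) e) ≤ 2 * S.card := by
    refine le_trans ?_ (sum_load_midLevel_le hT le_rfl h S)
    rw [← midLevel_of_mem (hN he)]
    exact Finset.single_le_sum (f := fun e => load β (midLevel f B T S e))
      (fun _ _ => Nat.zero_le _) (hN he)
  have h2 : S.card * S.card ≤ 2 * S.card := by
    calc S.card * S.card ≤ β ^ r * β ^ r := Nat.mul_le_mul hβ hβ
      _ = β ^ (2 * r) := by rw [← pow_add, two_mul]
      _ ≤ load β (2 * r + 1) := by rw [load_succ]; omega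
      _ ≤ _ := (load_mono β hlev).trans h1
  nlinarith

end Levels

/-! ### Expectations of nonnegative functions -/

/-- The expectation of a nonnegative function. -/
noncomputable def PMF.expect {α : Type*} (μ : PMF α) (Φ : α → ENNReal) : ENNReal :=
  ∑' a, μ a * Φ a

namespace PMF

variable {α β : Type*}

theorem expect_pure (a : α) (Φ : α → ENNReal) : (PMF.pure a).expect Φ = Φ a := by
  unfold expect
  rw [tsum_eq_single a fun b hb => by simp [PMF.pure_apply_of_ne _ _ hb]]
  simp

theorem expect_bind (μ : PMF α) (κ : α → PMF β) (Φ : β → ENNReal) :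
    (μ.bind κ).expect Φ = μ.expect fun a => (κ a).expect Φ := by
  unfold expect
  simp only [PMF.bind_apply, ← ENNReal.tsum_mul_right, ← ENNReal.tsum_mul_left]
  rw [ENNReal.tsum_comm]
  simp only [mul_assoc]

theorem expect_map (μ : PMF α) (g : α → β) (Φ : β → ENNReal) :
    (μ.map g).expect Φ = μ.expect fun a => Φ (g a) := by
  rw [← PMF.bind_pure_comp, expect_bind]
  simp only [Function.comp, expect_pure]

theorem expect_mono {μ : PMF α} {Φ Ψ : α → ENNReal} (h : ∀ a ∈ μ.support, Φ a ≤ Ψ a) :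
    μ.expect Φ ≤ μ.expect Ψ := by
  refine ENNReal.tsum_le_tsum fun a => ?_
  by_cases ha : μ a = 0
  · simp [ha]
  · exact mul_le_mul_right (h a ((μ.mem_support_iff a).2 ha)) _

/-- Markov's inequality. -/
theorem one_sub_le_toOuterMeasure {μ : PMF α} {Φ : α → ENNReal} {G : Set α} {Θ : ENNReal}
    (hΘ : Θ ≠ 0) (hΘ' : Θ ≠ ⊤) (h : ∀ a ∈ μ.support, a ∉ G → Θ ≤ Φ a) :
    1 - μ.expect Φ / Θ ≤ μ.toOuterMeasure G := by
  classical
  rw [tsub_le_iff_right, PMF.toOuterMeasure_apply, ← μ.tsum_coe, expect, div_eq_mul_inv,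
    ← ENNReal.tsum_mul_right, ← ENNReal.tsum_add]
  refine ENNReal.tsum_le_tsum fun a => ?_
  by_cases ha : a ∈ G
  · simp [ha]
  · by_cases h0 : μ a = 0
    · simp [h0]
    · have h1 := h a ((μ.mem_support_iff a).2 h0) ha
      calc μ a = μ a * (Θ * Θ⁻¹) := by rw [ENNReal.mul_inv_cancel hΘ hΘ', mul_one]
        _ ≤ μ a * Φ a * Θ⁻¹ := by rw [mul_assoc]; gcongr
        _ ≤ _ := le_add_self

theorem expect_uniformOfFintype [Fintype α] [Nonempty α] (Φ : α → ℝ) (hΦ : ∀ a, 0 ≤ Φ a) :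
    (PMF.uniformOfFintype α).expect (fun a => ENNReal.ofReal (Φ a)) =
      ENNReal.ofReal ((∑ a, Φ a) / Fintype.card α) := by
  unfold expect
  have hc : (0 : ℝ) < Fintype.card α := by exact_mod_cast Fintype.card_pos
  rw [tsum_fintype, ENNReal.ofReal_div_of_pos hc, ENNReal.ofReal_sum_of_nonneg fun a _ => hΦ a,
    ENNReal.ofReal_natCast, div_eq_mul_inv, mul_comm, Finset.mul_sum]
  simp

end PMF

/-! ### Dyadic coins -/

/-- The number of `z < N` with `z * n < N * a`. -/
theorem card_filter_mul_lt {N n a : ℕ} (hn : 0 < n) :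
    (Finset.univ.filter fun z : Fin N => z.val * n < N * a).card =
      min N ⌈(N * a : ℝ) / n⌉₊ := by
  have hn' : (0 : ℝ) < n := by exact_mod_cast hn
  rw [← Fin.card_filter_val_lt]
  congr 1
  refine Finset.filter_congr fun z _ => ?_
  rw [Nat.lt_ceil, lt_div_iff₀ hn']
  norm_cast

/-- The probability that a uniform `z < N` satisfies `z * n < N * a`. -/
noncomputable def coinProb (N n a : ℕ) : ℝ :=
  ((Finset.univ.filter fun z : Fin N => z.val * n < N * a).card : ℝ) / N

theorem coinProb_nonneg (N n a : ℕ) : 0 ≤ coinProb N n a := by unfold coinProb; positivity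

/-- The coin rounds `a / n` up to a multiple of `1 / N` (capped at 1), so its success probability is
never below `min 1 (a / n)`. -/
theorem one_sub_coinProb_le {N n : ℕ} (a : ℕ) (hN : 0 < N) (hn : 0 < n) :
    1 - coinProb N n a ≤ Real.exp (-((a : ℝ) / n)) := by
  have hN' : (0 : ℝ) < N := by exact_mod_cast hN
  rw [coinProb, card_filter_mul_lt hn]
  rcases le_total N ⌈(N * a : ℝ) / n⌉₊ with h | h
  · rw [min_eq_left h, div_self hN'.ne', sub_self]
    exact (Real.exp_pos _).le
  · rw [min_eq_right h]
    have h1 : (a : ℝ) / n ≤ (⌈(N * a : ℝ) / n⌉₊ : ℝ) / N := by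
      rw [le_div_iff₀ hN']
      refine le_trans (le_of_eq ?_) (Nat.le_ceil _)
      ring
    have h2 := Real.add_one_le_exp (-((a : ℝ) / n))
    linarith

/-- Rounding adds at most `1 / N ≤ 1 / n ≤ a / n`, whence the factor 2. -/
theorem coinProb_le {N n a : ℕ} (hN : n ≤ N) (hn : 0 < n) (ha : 0 < a) :
    coinProb N n a ≤ 2 * ((a : ℝ) / n) := by
  have hn' : (0 : ℝ) < n := by exact_mod_cast hn
  have hN' : (0 : ℝ) < N := by exact_mod_cast hn.trans_le hN
  have hNn : (n : ℝ) ≤ N := by exact_mod_cast hN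
  have ha' : (1 : ℝ) ≤ a := by exact_mod_cast ha
  rw [coinProb, card_filter_mul_lt hn, div_le_iff₀ hN']
  have h1 : ((min N ⌈(N * a : ℝ) / n⌉₊ : ℕ) : ℝ) ≤ (⌈(N * a : ℝ) / n⌉₊ : ℝ) := by
    exact_mod_cast min_le_right _ _
  have h2 := (Nat.ceil_lt_add_one (a := (N * a : ℝ) / n) (by positivity)).le
  have h3 : (1 : ℝ) ≤ (a : ℝ) / n * N := by
    rw [div_mul_eq_mul_div, le_div_iff₀ hn']
    nlinarith
  have h4 : (N * a : ℝ) / n = (a : ℝ) / n * N := by ring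
  linarith

theorem expect_coin {α : Type*} {N n a : ℕ} [NeZero N] (g : Fin N → α) {Φ : α → ENNReal}
    {A B : ℝ} (hA : 0 ≤ A) (hB : 0 ≤ B)
    (h : ∀ z, Φ (g z) ≤ ENNReal.ofReal (if z.val * n < N * a then A else B)) :
    ((PMF.uniformOfFintype (Fin N)).map g).expect Φ ≤
      ENNReal.ofReal (coinProb N n a * A + (1 - coinProb N n a) * B) := by
  rw [PMF.expect_map]
  refine (PMF.expect_mono fun z _ => h z).trans ?_
  rw [PMF.expect_uniformOfFintype (fun z : Fin N => if z.val * n < N * a then A else B)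
    fun z => by split_ifs <;> assumption]
  refine ENNReal.ofReal_le_ofReal (le_of_eq ?_)
  have hN : (N : ℝ) ≠ 0 := by exact_mod_cast NeZero.ne N
  have hsplit := Finset.card_filter_add_card_filter_not (s := (Finset.univ : Finset (Fin N)))
    (fun z : Fin N => z.val * n < N * a)
  rw [Finset.card_univ, Fintype.card_fin] at hsplit
  have hsplit' : ((Finset.univ.filter fun z : Fin N => ¬ z.val * n < N * a).card : ℝ) =
      N - (Finset.univ.filter fun z : Fin N => z.val * n < N * a).card := by
    rw [eq_sub_iff_add_eq, add_comm]
    exact_mod_cast hsplit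
  rw [Finset.sum_ite, Finset.sum_const, Finset.sum_const, nsmul_eq_mul, nsmul_eq_mul, hsplit',
    coinProb, Fintype.card_fin]
  field_simp

/-! ### The potential of a sample -/

section Potential

variable {U : Type*} [DecidableEq U]

/-- The potential of a sample `A` for the loads `L`, with `m` counted elements. -/
noncomputable def potential (F : Finset (Finset U)) (S : Finset U) (q n : ℕ) (A : Finset U)
    (L : U → ℕ) (m : ℕ) : ℝ :=
  ∑ V ∈ F, (if Disjoint V A then Real.exp ((q : ℝ) * ((∑ e ∈ V, L e : ℕ) : ℝ) / n) else 0) +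
    Real.exp (m - 4 * ((q : ℝ) * ((∑ e ∈ S, L e : ℕ) : ℝ) / n))

variable {F : Finset (Finset U)} {S A : Finset U} {q n m : ℕ} {L L' : U → ℕ}

theorem potential_nonneg : 0 ≤ potential F S q n A L m := by
  unfold potential
  refine add_nonneg (Finset.sum_nonneg fun V _ => ?_) (Real.exp_pos _).le
  split_ifs
  · exact (Real.exp_pos _).le
  · exact le_rfl

theorem potential_congr (hF : ∀ V ∈ F, V ⊆ S) (h : ∀ e ∈ S, L e = L' e) :
    potential F S q n A L m = potential F S q n A L' m := by
  unfold potential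
  rw [Finset.sum_congr rfl h]
  congr 1
  refine Finset.sum_congr rfl fun V hV => ?_
  rw [Finset.sum_congr rfl fun e he => h e (hF V hV he)]

theorem exp_le_potential_of_disjoint {V : Finset U} (hV : V ∈ F) (hA : Disjoint V A) :
    Real.exp ((q : ℝ) * ((∑ e ∈ V, L e : ℕ) : ℝ) / n) ≤ potential F S q n A L m := by
  unfold potential
  refine le_add_of_le_of_nonneg ?_ (Real.exp_pos _).le
  refine le_trans (le_of_eq ?_) (Finset.single_le_sum (f := fun V => if Disjoint V A then
    Real.exp ((q : ℝ) * ((∑ e ∈ V, L e : ℕ) : ℝ) / n) else 0) (fun V _ => ?_) hV)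
  · simp [hA]
  · split_ifs
    · exact (Real.exp_pos _).le
    · exact le_rfl

theorem exp_le_potential :
    Real.exp (m - 4 * ((q : ℝ) * ((∑ e ∈ S, L e : ℕ) : ℝ) / n)) ≤ potential F S q n A L m := by
  unfold potential
  refine le_add_of_nonneg_left (Finset.sum_nonneg fun V _ => ?_)
  split_ifs
  · exact (Real.exp_pos _).le
  · exact le_rfl

theorem potential_zero (hL : ∀ e ∈ S, L e = 0) (hF : ∀ V ∈ F, V ⊆ S) :
    potential F S q n ∅ L 0 = F.card + 1 := by
  rw [potential_congr (L' := fun _ => 0) hF hL]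
  simp [potential]

theorem sum_add_ite {V : Finset U} {x : U} {g : ℕ}
    (hL : ∀ e, L' e = L e + if e = x then g else 0) :
    ∑ e ∈ V, L' e = ∑ e ∈ V, L e + if x ∈ V then g else 0 := by
  simp [hL, Finset.sum_add_distrib]

/-- A set `V` containing `x` survives only if `x` is not sampled; this has probability at most `exp
(-q g / n)`, which cancels the growth of its weight. Sets without `x` keep their weight and status.
In the last term, the larger load of `S` compensates the expected growth of `exp m`. -/
theorem potential_sample_le {x : U} {g : ℕ} {p : ℝ} (hx : x ∈ S)
    (hL : ∀ e, L' e = L e + if e = x then g else 0) (hp0 : 0 ≤ p)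
    (h1 : 1 - p ≤ Real.exp (-((q : ℝ) * g / n))) (h2 : p ≤ 2 * ((q : ℝ) * g / n)) :
    p * potential F S q n (insert x A) L' (m + 1) + (1 - p) * potential F S q n A L' m ≤
      potential F S q n A L m := by
  have hsum : ∀ V ∈ F,
      p * (if Disjoint V (insert x A) then
        Real.exp ((q : ℝ) * ((∑ e ∈ V, L' e : ℕ) : ℝ) / n) else 0) +
      (1 - p) * (if Disjoint V A then
        Real.exp ((q : ℝ) * ((∑ e ∈ V, L' e : ℕ) : ℝ) / n) else 0) ≤
      (if Disjoint V A then Real.exp ((q : ℝ) * ((∑ e ∈ V, L e : ℕ) : ℝ) / n) else 0) := by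
    intro V _
    simp only [sum_add_ite hL, Finset.disjoint_insert_right]
    by_cases hA : Disjoint V A
    · by_cases hxV : x ∈ V
      · simp only [hA, hxV, if_true, not_true, false_and, if_false, mul_zero, zero_add]
        calc (1 - p) * Real.exp ((q : ℝ) * ((∑ e ∈ V, L e + g : ℕ) : ℝ) / n)
            ≤ Real.exp (-((q : ℝ) * g / n)) *
              Real.exp ((q : ℝ) * ((∑ e ∈ V, L e + g : ℕ) : ℝ) / n) := by gcongr
          _ = Real.exp ((q : ℝ) * ((∑ e ∈ V, L e : ℕ) : ℝ) / n) := by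
              rw [← Real.exp_add]; congr 1; push_cast; ring
      · simp only [hA, hxV, if_true, not_false_iff, true_and, if_false, add_zero]
        exact le_of_eq (by ring)
    · simp [hA]
  have hm : p * Real.exp ((m + 1 : ℕ) - 4 * ((q : ℝ) * ((∑ e ∈ S, L' e : ℕ) : ℝ) / n)) +
      (1 - p) * Real.exp (m - 4 * ((q : ℝ) * ((∑ e ∈ S, L' e : ℕ) : ℝ) / n)) ≤
      Real.exp (m - 4 * ((q : ℝ) * ((∑ e ∈ S, L e : ℕ) : ℝ) / n)) := by
    rw [sum_add_ite hL, if_pos hx]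
    set X := (m : ℝ) - 4 * ((q : ℝ) * ((∑ e ∈ S, L e : ℕ) : ℝ) / n) with hX
    set y := (q : ℝ) * g / n with hy
    have e1 : ((m + 1 : ℕ) : ℝ) - 4 * ((q : ℝ) * ((∑ e ∈ S, L e + g : ℕ) : ℝ) / n) =
        X + (-(4 * y) + 1) := by rw [hX, hy]; push_cast; ring
    have e2 : (m : ℝ) - 4 * ((q : ℝ) * ((∑ e ∈ S, L e + g : ℕ) : ℝ) / n) = X + -(4 * y) := by
      rw [hX, hy]; push_cast; ring
    rw [e1, e2, Real.exp_add, Real.exp_add, Real.exp_add]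
    have h3 : Real.exp 1 ≤ 3 := Real.exp_one_lt_d9.le.trans (by norm_num)
    -- The constant 4 in the potential: `e - 1 ≤ 2` and `p ≤ 2y`.
    have h4 : 1 + p * (Real.exp 1 - 1) ≤ Real.exp (4 * y) := by
      have := Real.add_one_le_exp (4 * y)
      nlinarith
    calc _ = Real.exp X * Real.exp (-(4 * y)) * (1 + p * (Real.exp 1 - 1)) := by ring
      _ ≤ Real.exp X * Real.exp (-(4 * y)) * Real.exp (4 * y) := by gcongr
      _ = Real.exp X := by rw [mul_assoc, ← Real.exp_add]; simp
  unfold potential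
  have := Finset.sum_le_sum hsum
  rw [Finset.sum_add_distrib, ← Finset.mul_sum, ← Finset.mul_sum] at this
  linarith

end Potential
/-! ### Single steps of a machine -/

namespace Machine

variable {b n : ℕ} {M : Machine b} {R : Type*} [LinearOrder R] {f : Finset (Constraint b) → R}
  {bas : Finset (Constraint b) → Finset (Constraint b)} {Tv : ℕ → ℕ → ℕ} {Tb : ℕ → ℕ}
  {stream : Fin n → Constraint b} {c : Config M}

theorem step_halt {i : Fin M.slots} (h : M.instr c.q = .halt i) :
    M.step f bas Tv Tb stream c = PMF.pure c := by
  unfold Machine.step; rw [h]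

theorem step_goto {q : M.Q} (h : M.instr c.q = .goto q) :
    M.step f bas Tv Tb stream c = PMF.pure (c.next q 1) := by
  unfold Machine.step; rw [h]

theorem step_random {k : Fin (2 ^ M.w) → M.Q} (h : M.instr c.q = .random k) :
    M.step f bas Tv Tb stream c =
      (PMF.uniformOfFintype (Fin (2 ^ M.w))).map fun z => c.next (k z) 1 := by
  unfold Machine.step; rw [h]

theorem step_read_some {k : Option (Constraint b) → M.Q} (h : M.instr c.q = .read k)
    (hp : c.pos < n) :
    M.step f bas Tv Tb stream c = PMF.pure (Config.next
      { c with
        pos := c.pos + 1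
        passes := if c.pos = 0 then c.passes + 1 else c.passes }
      (k (some (stream ⟨c.pos, hp⟩))) 1) := by
  unfold Machine.step; rw [h]; simp only [hp, dif_pos]

theorem step_read_none {k : Option (Constraint b) → M.Q} (h : M.instr c.q = .read k)
    (hp : ¬ c.pos < n) :
    M.step f bas Tv Tb stream c = PMF.pure (Config.next { c with pos := 0 } (k none) 1) := by
  unfold Machine.step; rw [h]; simp only [hp, dif_neg, not_false_iff]

theorem step_store {i : Fin M.slots} {x : Constraint b} {q : M.Q}
    (h : M.instr c.q = .store i x q) :
    M.step f bas Tv Tb stream c = PMF.pure ((c.write i (insert x (c.mem i))).next q 1) := by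
  unfold Machine.step; rw [h]

theorem step_basis {i j : Fin M.slots} {q : M.Q} (h : M.instr c.q = .basis i j q) :
    M.step f bas Tv Tb stream c =
      PMF.pure ((c.write j (bas (c.mem i))).next q (1 + Tb (c.mem i).card)) := by
  unfold Machine.step; rw [h]

theorem step_test {i : Fin M.slots} {x : Constraint b} {k : Bool → M.Q}
    (h : M.instr c.q = .test i x k) :
    M.step f bas Tv Tb stream c = PMF.pure (Config.next
        { c with tests := Function.update c.tests i (c.tests i + 1) }
        (k (decide (f (c.mem i) < f (insert x (c.mem i)))))
        (1 + testCost Tv (c.tests i) (c.mem i).card)) := by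
  unfold Machine.step; rw [h]

end Machine

/-! ### The machine -/

/-- Change the control states of an instruction. -/
def Instr.map {b w s : ℕ} {Q Q' : Type} (g : Q → Q') : Instr b w s Q → Instr b w s Q'
  | .halt i => .halt i
  | .goto q => .goto (g q)
  | .random k => .random fun z => g (k z)
  | .read k => .read fun o => g (k o)
  | .store i x q => .store i x (g q)
  | .clear i q => .clear i (g q)
  | .basis i j q => .basis i j (g q)
  | .test i x k => .test i x fun u => g (k u)

/-- The modes of the reweighting machine. -/
inductive Mode : Type
  /-- about to read the next constraint -/
  | scan
  /-- a constraint has been read, and is to be tested against the current basis -/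
  | probe
  /-- the constraint violates the current basis, and its earlier hits are being counted -/
  | count
  /-- the constraint is to be added to the sample -/
  | keep
  /-- the pass is over, and the tests against the current basis are to be reset -/
  | refresh
  /-- a basis of the sample is to be computed -/
  | select
  /-- stop -/
  | done
  deriving DecidableEq

instance : Fintype Mode where
  elems := {.scan, .probe, .count, .keep, .refresh, .select, .done}
  complete := fun x => by cases x <;> decide

/-- The control states of the reweighting machine. -/
@[ext]
structure Ctrl (b : ℕ) : Type where
  /-- the mode -/
  mode : Mode
  /-- the constraint that has been read last -/
  x : Constraint b
  /-- the number of the pass -/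
  t : ℕ
  /-- the number of constraints added to the sample -/
  m : ℕ
  /-- the number of hits -/
  h : ℕ
  /-- the number of passes whose hits of `x` have been counted -/
  s : ℕ
  /-- the number of hits of `x` in these passes -/
  v : ℕ

/-- The parameters of the reweighting machine. -/
structure Params : Type where
  /-- the number of constraints -/
  n : ℕ
  /-- the number of passes after the first one -/
  T : ℕ
  /-- the largest number of constraints added to the sample -/
  M : ℕ
  /-- the expected size of the first sample -/
  q : ℕ
  /-- the factor by which the sampling rate of a constraint grows when it is hit -/
  β : ℕ
  /-- the number of bits of the registers -/
  w : ℕ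

namespace Params

variable (P : Params) {b : ℕ}

/-- The control states that fit into the registers. -/
def Bounded (q : Ctrl b) : Prop :=
  q.t ≤ P.T ∧ q.m ≤ P.M ∧ q.h ≤ 2 * P.n ∧ q.s ≤ P.T ∧ q.v ≤ P.T

/-- The control states that fit into the registers. -/
abbrev State (b : ℕ) : Type := {q : Ctrl b // P.Bounded q}

/-- The control states as tuples of bounded numbers. -/
def encode (q : P.State b) : Mode × Constraint b × Fin (P.T + 1) × Fin (P.M + 1) ×
    Fin (2 * P.n + 1) × Fin (P.T + 1) × Fin (P.T + 1) :=
  (q.1.mode, q.1.x, ⟨q.1.t, Nat.lt_succ_of_le q.2.1⟩, ⟨q.1.m, Nat.lt_succ_of_le q.2.2.1⟩,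
    ⟨q.1.h, Nat.lt_succ_of_le q.2.2.2.1⟩, ⟨q.1.s, Nat.lt_succ_of_le q.2.2.2.2.1⟩,
    ⟨q.1.v, Nat.lt_succ_of_le q.2.2.2.2.2⟩)

theorem encode_injective : Function.Injective (P.encode (b := b)) := by
  intro q q' h
  simp only [encode, Prod.mk.injEq, Fin.mk.injEq] at h
  obtain ⟨h1, h2, h3, h4, h5, h6, h7⟩ := h
  exact Subtype.ext (Ctrl.ext h1 h2 h3 h4 h5 h6 h7)

noncomputable instance : Fintype (P.State b) := Fintype.ofInjective _ P.encode_injective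

theorem card_state_le : Fintype.card (P.State b) ≤
    7 * (2 ^ b * ((P.T + 1) * ((P.M + 1) * ((2 * P.n + 1) * ((P.T + 1) * (P.T + 1)))))) := by
  refine (Fintype.card_le_of_injective _ P.encode_injective).trans (le_of_eq ?_)
  simp only [Fintype.card_prod, Fintype.card_fin, Constraint, Fintype.card_fun, Fintype.card_bool]
  rfl

/-- The initial control state. -/
def start : P.State b := ⟨⟨.scan, fun _ => false, 0, 0, 0, 0, 0⟩, by simp [Bounded]⟩

open Classical in
/-- Stop if the control state does not fit into the registers. -/
noncomputable def guard (q : Ctrl b) : P.State b :=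
  if h : P.Bounded q then ⟨q, h⟩ else ⟨⟨.done, fun _ => false, 0, 0, 0, 0, 0⟩, by simp [Bounded]⟩

theorem guard_val {q : Ctrl b} (h : P.Bounded q) : (P.guard q).1 = q := by
  simp [guard, h]

theorem guard_mode {q : Ctrl b} (h : ¬ P.Bounded q) : (P.guard q).1.mode = .done := by
  simp [guard, h]

/-- Slot `0` holds the sample, slot `s` the basis computed before pass `s`. -/
def slot (s : ℕ) : Fin (P.T + 1) := Fin.ofNat (P.T + 1) s

theorem slot_val {s : ℕ} (h : s ≤ P.T) : (P.slot s).val = s :=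
  Nat.mod_eq_of_lt (Nat.lt_succ_of_le h)

theorem slot_ne_zero {s : ℕ} (h : s ≤ P.T) (h0 : s ≠ 0) : P.slot s ≠ 0 := fun he =>
  h0 (by rw [← P.slot_val h, he]; rfl)

theorem slot_ne {s t : ℕ} (hs : s ≤ P.T) (ht : t ≤ P.T) (h : s ≠ t) : P.slot s ≠ P.slot t :=
  fun he => h (by rw [← P.slot_val hs, he, P.slot_val ht])

/-- The program of the reweighting machine. -/
def program (q : Ctrl b) : Instr b P.w (P.T + 1) (Ctrl b) :=
  match q.mode with
  | .scan => .read fun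
      | none => { q with mode := .refresh }
      | some x => { q with mode := .probe, x := x }
  | .probe =>
      if q.t = 0 then .goto { q with mode := .count, h := q.h + 1, s := 0, v := 0 }
      else .test (P.slot q.t) q.x fun u =>
        -- Counting starts at `s = 1` with `v = 1`: everything was hit in pass 0, which has no basis
        -- to test against. The current pass is not counted in `v`.
        if u then { q with mode := .count, h := q.h + 1, s := 1, v := 1 }
        else { q with mode := .scan }
  | .count =>
      if q.s < q.t then .test (P.slot q.s) q.x fun u =>
        { q with mode := .count, s := q.s + 1, v := q.v + if u then 1 else 0 }
      else .random fun z =>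
        if z.val * P.n < 2 ^ P.w * (P.q * P.β ^ q.v) then { q with mode := .keep, m := q.m + 1 }
        else { q with mode := .scan }
  | .keep => .store 0 q.x { q with mode := .scan }
  | .refresh =>
      if q.t = 0 then .goto { q with mode := .select, t := q.t + 1 }
      -- The slot keeps its content, and its count of tests returns to zero.
      else .basis (P.slot q.t) (P.slot q.t) { q with mode := .select, t := q.t + 1 }
  | .select => .basis 0 (P.slot q.t) { q with mode := .scan }
  | .done => .halt 0

/-- The reweighting machine. -/
noncomputable abbrev machine (hw : Fintype.card (P.State b) ≤ 2 ^ P.w) : Machine b where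
  w := P.w
  slots := P.T + 1
  Q := P.State b
  fintypeQ := inferInstance
  card_le := hw
  start := P.start
  instr := fun q => (P.program q.1).map P.guard

end Params
/-! ### Problems for the machine -/

/-- An LP-type problem with an order of the stream, a basis procedure, and cost functions, for
which the parameters `P` are suitable. -/
structure Setting (P : Params) (b : ℕ) (R : Type*) [LinearOrder R] where
  f : Finset (Constraint b) → R
  S : Finset (Constraint b)
  K : Constraint b → Set R
  bas : Finset (Constraint b) → Finset (Constraint b)
  stream : Fin P.n → Constraint b
  Tv : ℕ → ℕ → ℕ
  Tb : ℕ → ℕ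
  ν : ℕ
  r : ℕ
  /-- the threshold of the potential -/
  Θ : ℝ
  card_S : S.card = P.n
  isMin : IsMinOfInter f S K
  combDim_le : combDim f S ≤ ν
  bas_spec : ∀ N ⊆ S, IsBasis f N (bas N)
  injective : Function.Injective stream
  range_eq : Set.range stream = (S : Set (Constraint b))
  Tv_mono : ∀ t t' m m', t ≤ t' → m ≤ m' → Tv t m ≤ Tv t' m'
  Tb_mono : Monotone Tb
  three_le : 3 ≤ P.n
  one_le_ν : 1 ≤ ν
  one_le_r : 1 ≤ r
  T_eq : P.T = ν * (2 * r)
  le_pow : P.n ≤ P.β ^ r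
  one_le_β : 1 ≤ P.β
  one_le_q : 1 ≤ P.q
  le_two_pow : P.n ≤ 2 ^ P.w
  ν_le : ν ≤ P.M
  Θ_nonneg : 0 ≤ Θ
  Θ_le_exp : Θ ≤ Real.exp ((P.q : ℝ) / (P.T * P.β))
  Θ_le_exp' : Θ ≤ Real.exp (P.M + 1 - 8 * P.q)

namespace Setting

variable {P : Params} {b : ℕ} {R : Type*} [LinearOrder R] (E : Setting P b R)

/-- The first `p` constraints of the stream. -/
def read (p : ℕ) : Finset (Constraint b) :=
  (Finset.univ.filter fun i : Fin P.n => i.val < p).image E.stream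

theorem read_zero : E.read 0 = ∅ := by simp [read]

theorem mem_S {x : Constraint b} : x ∈ E.S ↔ ∃ i, E.stream i = x := by
  rw [← Finset.mem_coe, ← E.range_eq, Set.mem_range]

theorem stream_mem (i : Fin P.n) : E.stream i ∈ E.S := E.mem_S.2 ⟨i, rfl⟩

theorem mem_read_n {x : Constraint b} (hx : x ∈ E.S) : x ∈ E.read P.n := by
  obtain ⟨i, rfl⟩ := E.mem_S.1 hx
  exact Finset.mem_image_of_mem _ (by simp)

theorem stream_not_mem_read (i : Fin P.n) : E.stream i ∉ E.read i := by
  intro h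
  obtain ⟨j, hj, hij⟩ := Finset.mem_image.1 h
  rw [E.injective hij] at hj
  simp at hj

theorem read_succ (i : Fin P.n) : E.read (i + 1) = insert (E.stream i) (E.read i) := by
  unfold read
  rw [← Finset.image_insert]
  congr 1
  ext j
  simp only [Finset.mem_filter, Finset.mem_univ, true_and, Finset.mem_insert]
  rw [Fin.ext_iff]
  omega

theorem T_pos (E : Setting P b R) : 0 < P.T := by
  have h1 := E.one_le_ν
  have h2 := E.one_le_r
  rw [E.T_eq]; positivity

theorem n_pos (E : Setting P b R) : 0 < P.n := by have := E.three_le; omega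

variable (B : ℕ → Finset (Constraint b))

/-- The potential of a run in pass `t`: the constraints in `D` have been read, the sample is `A`,
and the bases are given by `B`. -/
noncomputable def pot (A : Finset (Constraint b)) (t : ℕ) (D : Finset (Constraint b)) (m : ℕ) : ℝ :=
  open Classical in
  if ∃ s, 1 ≤ s ∧ s ≤ t ∧ Heavy E.f B E.S P.T P.β s then E.Θ
  else potential (exclusionFamily E.S E.K) E.S P.q P.n A
    (fun e => load P.β (midLevel E.f B t D e)) m

variable {B} {A D : Finset (Constraint b)} {t m : ℕ}

theorem pot_nonneg : 0 ≤ E.pot B A t D m := by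
  unfold pot
  split_ifs
  · exact E.Θ_nonneg
  · exact potential_nonneg

theorem pot_congr {B' : ℕ → Finset (Constraint b)} (h : ∀ s, s ≤ t → s ≠ 0 → B s = B' s) :
    E.pot B A t D m = E.pot B' A t D m := by
  unfold pot
  have h1 : (∃ s, 1 ≤ s ∧ s ≤ t ∧ Heavy E.f B E.S P.T P.β s) ↔
      ∃ s, 1 ≤ s ∧ s ≤ t ∧ Heavy E.f B' E.S P.T P.β s := by
    refine exists_congr fun s => and_congr_right fun _ => and_congr_right fun hs => ?_
    exact heavy_congr fun s' hs' => h s' (hs'.trans hs)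
  simp only [midLevel_congr D h]
  by_cases h2 : ∃ s, 1 ≤ s ∧ s ≤ t ∧ Heavy E.f B E.S P.T P.β s
  · rw [if_pos h2, if_pos (h1.1 h2)]
  · rw [if_neg h2, if_neg (mt h1.2 h2)]

theorem pot_of_not_heavy (h : ¬ ∃ s, 1 ≤ s ∧ s ≤ t ∧ Heavy E.f B E.S P.T P.β s) :
    E.pot B A t D m = potential (exclusionFamily E.S E.K) E.S P.q P.n A
      (fun e => load P.β (midLevel E.f B t D e)) m := by
  rw [pot, if_neg h]

theorem pot_of_heavy (h : ∃ s, 1 ≤ s ∧ s ≤ t ∧ Heavy E.f B E.S P.T P.β s) :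
    E.pot B A t D m = E.Θ := by
  rw [pot, if_pos h]

theorem pot_insert_of_not_hit {x : Constraint b} (h : ¬ Hit E.f B t x) :
    E.pot B A t (insert x D) m = E.pot B A t D m := by
  unfold pot
  simp only [midLevel_insert_of_not_hit h]

/-- The potential does not increase on average when a constraint is sampled. -/
theorem pot_sample_le {x : Constraint b} (hx : x ∈ E.S) (hxD : x ∉ D) (h : Hit E.f B t x) :
    coinProb (2 ^ P.w) P.n (P.q * P.β ^ level E.f B t x) * E.pot B (insert x A) t (insert x D) (m + 1) +
      (1 - coinProb (2 ^ P.w) P.n (P.q * P.β ^ level E.f B t x)) * E.pot B A t (insert x D) m ≤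
      E.pot B A t D m := by
  have hβ := E.one_le_β
  have hq := E.one_le_q
  unfold pot
  split_ifs with hheavy
  · exact le_of_eq (by ring)
  · have h1 := one_sub_coinProb_le (N := 2 ^ P.w) (P.q * P.β ^ level E.f B t x)
      (Nat.two_pow_pos P.w) E.n_pos
    have h2 := coinProb_le (a := P.q * P.β ^ level E.f B t x) E.le_two_pow E.n_pos
      (by positivity)
    push_cast at h1 h2
    refine potential_sample_le (g := P.β ^ level E.f B t x) hx (fun e => ?_)
      (coinProb_nonneg _ _ _) (by push_cast; exact h1) (by push_cast; exact h2)
    rw [midLevel_insert_of_hit hxD h]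
    by_cases he : e = x
    · subst he
      rw [if_pos rfl, if_pos rfl, load_succ, midLevel_of_not_mem hxD]
    · simp [he]

theorem subset_of_mem_family {V : Finset (Constraint b)} (hV : V ∈ exclusionFamily E.S E.K) :
    V ⊆ E.S := subset_of_mem_exclusionFamily hV

/-- The potential does not increase when a basis of the sample is computed. -/
theorem pot_select_le {B' : ℕ → Finset (Constraint b)} (hA : A ⊆ E.S)
    (hB : ∀ s, s ≤ t → s ≠ 0 → B s = B' s) (hB' : B' (t + 1) = E.bas A) :
    E.pot B' A (t + 1) ∅ m ≤ E.pot B A t (E.read P.n) m := by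
  classical
  rw [E.pot_congr hB]
  -- After an earlier heavy pass both sides are frozen at `Θ`. If only pass `t + 1` is heavy, the
  -- old potential must already be at least `Θ`.
  by_cases hold : ∃ s, 1 ≤ s ∧ s ≤ t ∧ Heavy E.f B' E.S P.T P.β s
  · rw [E.pot_of_heavy hold, E.pot_of_heavy]
    obtain ⟨s, h1, h2, h3⟩ := hold
    exact ⟨s, h1, h2.trans (Nat.le_succ t), h3⟩
  · have hlev : ∀ e ∈ E.S, midLevel E.f B' t (E.read P.n) e = level E.f B' (t + 1) e :=
      fun e he => midLevel_of_mem (E.mem_read_n he)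
    rw [E.pot_of_not_heavy hold]
    by_cases hnew : ∃ s, 1 ≤ s ∧ s ≤ t + 1 ∧ Heavy E.f B' E.S P.T P.β s
    · rw [E.pot_of_heavy hnew]
      have hh : Heavy E.f B' E.S P.T P.β (t + 1) := by
        obtain ⟨s, h1, h2, h3⟩ := hnew
        rcases h2.lt_or_eq with h | rfl
        · exact absurd ⟨s, h1, Nat.lt_succ_iff.1 h, h3⟩ hold
        · exact h3
      have hbas := E.bas_spec A hA
      have hBS : B' (t + 1) ⊆ E.S := by rw [hB']; exact hbas.1.trans hA
      have hfil : E.S.filter (Hit E.f B' (t + 1)) =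
          E.S.filter fun e => E.f (B' (t + 1)) < E.f (insert e (B' (t + 1))) :=
        Finset.filter_congr fun e _ => by simp [Hit]
      -- The violators of the new basis are an exclusion set that the sample misses, so their term
      -- occurs in the potential; heaviness makes its exponent at least `q / (Tβ)`.
      have hmem : E.S.filter (Hit E.f B' (t + 1)) ∈ exclusionFamily E.S E.K := by
        rw [hfil]
        convert filter_violates_mem_exclusionFamily E.isMin hBS
      have hdisj : Disjoint (E.S.filter (Hit E.f B' (t + 1))) A := by
        rw [hfil, Finset.disjoint_left]
        intro e he heA
        rw [Finset.mem_filter] at he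
        exact not_violates_of_mem E.isMin hBS hA (by rw [hB']; exact hbas.2.1) heA he.2
      refine le_trans ?_ (exp_le_potential_of_disjoint hmem hdisj)
      refine E.Θ_le_exp.trans (Real.exp_le_exp.2 ?_)
      have hT : (0 : ℝ) < P.T := by exact_mod_cast E.T_pos
      have hβ : (0 : ℝ) < P.β := by exact_mod_cast E.one_le_β
      have hn : (0 : ℝ) < P.n := by exact_mod_cast E.n_pos
      rw [Finset.sum_congr rfl fun e he => by rw [hlev e (Finset.mem_filter.1 he).1]]
      unfold Heavy at hh
      rw [E.card_S] at hh
      rw [div_le_div_iff₀ (by positivity) hn, mul_assoc]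
      refine mul_le_mul_of_nonneg_left ?_ (Nat.cast_nonneg _)
      refine le_trans (Nat.cast_le.2 hh.le) (le_of_eq ?_)
      push_cast
      rw [mul_comm]
    · rw [E.pot_of_not_heavy hnew]
      refine le_of_eq (potential_congr (fun V hV => E.subset_of_mem_family hV) fun e he => ?_)
      rw [hlev e he, midLevel_of_not_mem (Finset.notMem_empty e)]

/-- Either the potential is large, or the loads are small. -/
theorem sum_load_le_or (D' : Finset (Constraint b)) (ht : t ≤ P.T) :
    (∑ e ∈ E.S, load P.β (midLevel E.f B t D' e) ≤ 2 * P.n ∧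
      ∀ s, 1 ≤ s → s ≤ t → ¬ Heavy E.f B E.S P.T P.β s) ∨ E.Θ = E.pot B A t D m := by
  by_cases h : ∃ s, 1 ≤ s ∧ s ≤ t ∧ Heavy E.f B E.S P.T P.β s
  · exact Or.inr (E.pot_of_heavy h).symm
  · push Not at h
    refine Or.inl ⟨?_, h⟩
    rw [← E.card_S]
    exact sum_load_midLevel_le E.T_pos ht h D'

/-- Each hit contributes at least 1 to the load, so more than `2n` hits are incompatible with the
absence of heavy passes. The set `D'` need not be the `D` of the potential, since the bound on loads
holds at every moment of the pass. -/
theorem le_pot_of_hits {D' : Finset (Constraint b)} (ht : t ≤ P.T)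
    (h : 2 * P.n < ∑ e ∈ E.S, midLevel E.f B t D' e) : E.Θ ≤ E.pot B A t D m := by
  rcases E.sum_load_le_or (B := B) (A := A) (D := D) (m := m) D' ht with h' | h'
  · exact absurd (h.trans_le (Finset.sum_le_sum fun e _ => le_load E.one_le_β _))
      (not_lt.2 h'.1)
  · exact h'.le

/-- With total load at most `2n`, the size term is at least `exp (M + 1 - 8q)`. -/
theorem le_pot_of_size (ht : t ≤ P.T) (h : P.M < m) : E.Θ ≤ E.pot B A t D m := by
  rcases E.sum_load_le_or (B := B) (A := A) (D := D) (m := m) D ht with h' | h'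
  · rw [E.pot_of_not_heavy (by push Not; exact h'.2)]
    refine le_trans ?_ exp_le_potential
    refine E.Θ_le_exp'.trans (Real.exp_le_exp.2 ?_)
    have hn : (0 : ℝ) < P.n := by exact_mod_cast E.n_pos
    have h1 : ((∑ e ∈ E.S, load P.β (midLevel E.f B t D e) : ℕ) : ℝ) / P.n ≤ 2 := by
      rw [div_le_iff₀ hn]; exact_mod_cast h'.1
    have h2 : (P.M : ℝ) + 1 ≤ m := by exact_mod_cast h
    have h3 := mul_le_mul_of_nonneg_left h1 (Nat.cast_nonneg (α := ℝ) P.q)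
    rw [mul_div_assoc]
    linarith
  · exact h'.le

theorem le_pot_of_ne (hB : ∀ s, 1 ≤ s → s ≤ P.T → B s ⊆ E.S)
    (hlt : ∀ s, 1 ≤ s → s ≤ P.T → E.f (B s) < E.f E.S) : E.Θ ≤ E.pot B A P.T D m := by
  rcases E.sum_load_le_or (B := B) (A := A) (D := D) (m := m) D le_rfl with h' | h'
  · have hb := E.bas_spec E.S subset_rfl
    rw [E.T_eq] at hB h' hlt
    obtain ⟨s, h1, h2, h3⟩ := exists_eq_of_not_heavy E.isMin E.one_le_ν E.one_le_r
      (by rw [E.card_S]; exact E.le_pow) (by rw [E.card_S]; exact E.three_le) hb.1 hb.2.1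
      ((hb.card_le_combDim subset_rfl).trans E.combDim_le) hB h'.2
    exact absurd (hlt s h1 h2) (not_lt.2 h3)
  · exact h'.le

end Setting
/-! ### The invariant of a run -/

/-- The cost of `t` tests against a set of size `m`. -/
def cumCost (Tv : ℕ → ℕ → ℕ) (t m : ℕ) : ℕ := if t = 0 then 0 else Tv t m

namespace Setting

variable {P : Params} {b : ℕ} {R : Type*} [LinearOrder R] (E : Setting P b R)

/-- The test costs telescope; monotonicity of `Tv` makes the truncated subtraction exact. -/
theorem cumCost_succ (t m : ℕ) :
    cumCost E.Tv (t + 1) m = cumCost E.Tv t m + testCost E.Tv t m := by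
  unfold cumCost testCost
  by_cases h : t = 0
  · simp [h]
  · have := E.Tv_mono t (t + 1) m m (Nat.le_succ t) le_rfl
    simp only [h, Nat.succ_ne_zero, if_false]
    omega

/-- The cost of one pass, apart from the steps of the machine and the counting of hits. -/
def passCost : ℕ := E.Tv P.n E.ν + 2 * E.Tb P.M

end Setting

/-- The number of steps that remain for the later passes and for counting hits. -/
def Params.baseRank (P : Params) (t h : ℕ) : ℕ :=
  (P.T - t) * (4 * P.n + 6) + (2 * P.n - h) * (P.T + 2)

/-- The number of steps that remain. -/
def Params.rank (P : Params) {b : ℕ} (q : Ctrl b) (pos : ℕ) : ℕ :=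
  match q.mode with
  | .scan => P.baseRank q.t q.h + 4 * (P.n - pos) + 4
  | .probe => P.baseRank q.t q.h + 4 * (P.n - pos) + 7
  | .count => P.baseRank q.t q.h + 4 * (P.n - pos) + (q.t - q.s) + 6
  | .keep => P.baseRank q.t q.h + 4 * (P.n - pos) + 5
  | .refresh => P.baseRank q.t q.h + 3
  | .select => P.baseRank q.t q.h + (4 * P.n + 6)
  | .done => 0

/-- The number of steps of a run. -/
def Params.steps (P : Params) : ℕ := P.baseRank 0 0 + 4 * P.n + 4

namespace Setting

variable {P : Params} {b : ℕ} {R : Type*} [LinearOrder R] (E : Setting P b R)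
  {hw : Fintype.card (P.State b) ≤ 2 ^ P.w}

/-- The bases in the slots. -/
def bases (c : Config (P.machine hw)) (s : ℕ) : Finset (Constraint b) := c.mem (P.slot s)

/-- The cost of the tests against the sets that are stored now. -/
def openCost (c : Config (P.machine hw)) : ℕ :=
  ∑ i : Fin (P.T + 1), cumCost E.Tv (c.tests i) (c.mem i).card

/-- A bound on the space. -/
def maxSpace : ℕ := P.w + b * (P.T + 1 + (P.M + P.T * E.ν))

/-- The invariant in pass `t` after `p` constraints, with `m` constraints added to the sample,
`h` hits, `ext i` additional tests against slot `i`, running time covered by `A` and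
`k` units of time to spare. -/
structure Core (c : Config (P.machine hw)) (t m h p : ℕ) (ext : Fin (P.T + 1) → ℕ)
    (A k : ℕ) : Prop where
  sub : ∀ i : Fin (P.T + 1), c.mem i ⊆ E.S
  small : ∀ i : Fin (P.T + 1), i ≠ 0 → (c.mem i).card ≤ E.ν
  fixed : ∀ i : Fin (P.T + 1), i ≠ 0 → E.bas (c.mem i) = c.mem i
  peak : c.peak ≤ E.maxSpace
  card : (c.mem (0 : Fin (P.T + 1))).card ≤ m
  t_le : t ≤ P.T
  m_le : m ≤ P.M
  h_le : h ≤ 2 * P.n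
  p_le : p ≤ P.n
  below : ∀ s, 1 ≤ s → s ≤ t → E.f (bases c s) ≤ E.f (c.mem (0 : Fin (P.T + 1)))
  passes : c.passes ≤ t + 1
  hits : h ≤ ∑ e ∈ E.S, midLevel E.f (bases c) t (E.read p) e
  le_hits : (if t = 0 then p else P.n) ≤ h
  tests_zero : c.tests (0 : Fin (P.T + 1)) = 0
  tests_lt : ∀ i : Fin (P.T + 1), i ≠ 0 → i.val < t → c.tests i + P.n ≤ h + ext i
  tests_eq : ∀ i : Fin (P.T + 1), i ≠ 0 → i.val = t → c.tests i ≤ p + ext i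
  tests_gt : ∀ i : Fin (P.T + 1), t < i.val → c.tests i = 0
  time : c.time + k ≤ P.steps + E.openCost c + A

/-- The bounds on a run that has stopped. -/
structure Final (c : Config (P.machine hw)) : Prop where
  passes : c.passes ≤ P.T + 1
  peak : c.peak ≤ E.maxSpace
  time : c.time ≤ P.steps + P.T * E.Tv P.n E.ν + (P.T + 1) * E.passCost

variable {E} {c : Config (P.machine hw)} {t m h p A k : ℕ} {ext : Fin (P.T + 1) → ℕ}

/-! ### Effect of single instructions on the invariant -/

theorem Core.space_le (hC : E.Core c t m h p ext A k) : c.space ≤ E.maxSpace := by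
  have h1 : ∑ i : Fin (P.T + 1), (c.mem i).card ≤ P.M + P.T * E.ν := by
    rw [Fin.sum_univ_succ]
    refine Nat.add_le_add (hC.card.trans hC.m_le) ?_
    calc ∑ i : Fin P.T, (c.mem i.succ).card ≤ ∑ _i : Fin P.T, E.ν :=
          Finset.sum_le_sum fun i _ => hC.small i.succ (Fin.succ_ne_zero i)
      _ = _ := by simp
  exact Nat.add_le_add_left (Nat.mul_le_mul_left _ (Nat.add_le_add_left h1 _)) _

/-- The `a` units spent now are paid out of the spare time `k` and a new allowance `j`. -/
theorem Core.next (hC : E.Core c t m h p ext A k) (q : P.State b) {a j k' : ℕ}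
    (hk : a + k' ≤ k + j) : E.Core (c.next q a) t m h p ext (A + j) k' where
  sub := hC.sub
  small := hC.small
  fixed := hC.fixed
  peak := max_le hC.peak hC.space_le
  card := hC.card
  t_le := hC.t_le
  m_le := hC.m_le
  h_le := hC.h_le
  p_le := hC.p_le
  below := hC.below
  passes := hC.passes
  hits := hC.hits
  le_hits := hC.le_hits
  tests_zero := hC.tests_zero
  tests_lt := hC.tests_lt
  tests_eq := hC.tests_eq
  tests_gt := hC.tests_gt
  time := by
    have h1 := hC.time
    have h2 : E.openCost (c.next q a) = E.openCost c := rfl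
    have h3 : (c.next q a).time = c.time + a := rfl
    omega

theorem Core.setPos (hC : E.Core c t m h p ext A k) (pos : ℕ) {passes : ℕ}
    (hp : passes ≤ t + 1) :
    E.Core { c with pos := pos, passes := passes } t m h p ext A k :=
  { hC with passes := hp }

/-- Each slot has at most `n` uncharged tests. For the current basis these come from the constraints
read in this pass. For an older one they come from the hits since its reset: at most `2n` hits in
all, of which at least `n` came before. -/
theorem Core.final (hC : E.Core c t m h p ext A k)
    (he : ∀ i : Fin (P.T + 1), i.val < t → ext i = 0) (he' : ∀ i, p + ext i ≤ P.n)
    (hA : A ≤ (P.T + 1) * E.passCost) :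
    E.Final c where
  passes := hC.passes.trans (Nat.succ_le_succ hC.t_le)
  peak := hC.peak
  time := by
    have h1 : E.openCost c ≤ P.T * E.Tv P.n E.ν := by
      unfold openCost
      rw [Fin.sum_univ_succ, hC.tests_zero, cumCost, if_pos rfl, zero_add]
      refine (Finset.sum_le_sum (g := fun _ => E.Tv P.n E.ν) fun i _ => ?_).trans (by simp)
      have h0 := Fin.succ_ne_zero i
      have ht : c.tests i.succ ≤ P.n := by
        have a1 := hC.tests_lt i.succ
        have a2 := hC.tests_eq i.succ
        have a3 := hC.tests_gt i.succ
        have a4 := hC.h_le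
        have a5 := he' i.succ
        rcases lt_trichotomy i.succ.val t with h' | h' | h'
        · have := a1 h0 h'; have := he _ h'; omega
        · have := a2 h0 h'; omega
        · have := a3 h'; omega
      unfold cumCost
      split_ifs
      · exact Nat.zero_le _
      · exact E.Tv_mono _ _ _ _ ht (hC.small _ h0)
    have := hC.time
    omega

theorem Core.test (hC : E.Core c t m h p ext A k) {s : ℕ} (h0 : s ≠ 0) (hs : s ≤ t)
    {ext' : Fin (P.T + 1) → ℕ} (he : ∀ i, ext' i = ext i + if i = P.slot s then 1 else 0) :
    E.Core { c with tests := Function.update c.tests (P.slot s) (c.tests (P.slot s) + 1) }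
      t m h p ext' A (k + testCost E.Tv (c.tests (P.slot s)) (c.mem (P.slot s)).card) := by
  have hsT := hs.trans hC.t_le
  have hup : ∀ i, (Function.update c.tests (P.slot s) (c.tests (P.slot s) + 1) :
      Fin (P.T + 1) → ℕ) i = c.tests i + if i = P.slot s then 1 else 0 := fun i => by
    by_cases hi : i = P.slot s
    · subst hi; simp
    · simp [hi]
  refine { hC with tests_zero := ?_, tests_lt := ?_, tests_eq := ?_, tests_gt := ?_, time := ?_ }
  · refine (hup 0).trans ?_
    rw [if_neg (P.slot_ne_zero hsT h0).symm, hC.tests_zero]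
  · intro i hi hit
    have h1 := hup i
    have h2 := he i
    have h3 := hC.tests_lt i hi hit
    dsimp only
    omega
  · intro i hi hit
    have h1 := hup i
    have h2 := he i
    have h3 := hC.tests_eq i hi hit
    dsimp only
    omega
  · intro i hi
    refine (hup i).trans ?_
    rw [if_neg fun h' => ?_, hC.tests_gt i hi]
    rw [h', P.slot_val hsT] at hi
    omega
  · have h1 := hC.time
    have h2 : E.openCost { c with
        tests := Function.update c.tests (P.slot s) (c.tests (P.slot s) + 1) } =
        E.openCost c + testCost E.Tv (c.tests (P.slot s)) (c.mem (P.slot s)).card := by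
      unfold openCost
      rw [← Finset.add_sum_erase _ _ (Finset.mem_univ (P.slot s)),
        ← Finset.add_sum_erase (a := P.slot s) _ (fun i : Fin (P.T + 1) =>
          cumCost E.Tv (c.tests i) (c.mem i).card) (Finset.mem_univ (P.slot s))]
      have h3 := hup (P.slot s)
      rw [if_pos rfl] at h3
      dsimp only
      have h4 : ∀ i ∈ Finset.univ.erase (P.slot s), cumCost E.Tv ((Function.update c.tests
          (P.slot s) (c.tests (P.slot s) + 1) : Fin (P.T + 1) → ℕ) i) (c.mem i).card =
          cumCost E.Tv (c.tests i) (c.mem i).card := fun i hi => by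
        rw [hup i, if_neg (Finset.ne_of_mem_erase hi), add_zero]
      rw [Finset.sum_congr rfl h4, h3, E.cumCost_succ]
      ring
    dsimp only at h2 ⊢
    omega

/-- The pending tests, at most one per slot, are charged: those against older bases to the new hit,
the one against the current basis to the new constraint. -/
theorem Core.hit {i : Fin P.n} (hC : E.Core c t m h i ext A k) (he : ∀ j, ext j ≤ 1)
    (hx : Hit E.f (bases c) t (E.stream i)) (hh : h + 1 ≤ 2 * P.n) :
    E.Core c t m (h + 1) (i + 1) 0 A k := by
  refine { hC with h_le := hh, p_le := i.2, hits := ?_, le_hits := ?_, tests_lt := ?_,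
                    tests_eq := ?_ }
  · rw [E.read_succ]
    simp only [midLevel_insert_of_hit (E.stream_not_mem_read i) hx]
    rw [Finset.sum_add_distrib, Finset.sum_ite_eq', if_pos (E.stream_mem i)]
    exact Nat.succ_le_succ hC.hits
  · have := hC.le_hits
    split_ifs at this ⊢ <;> omega
  · intro j hj hjt
    have h1 := hC.tests_lt j hj hjt
    have h2 := he j
    simp only [Pi.zero_apply]; omega
  · intro j hj hjt
    have h1 := hC.tests_eq j hj hjt
    have h2 := he j
    simp only [Pi.zero_apply]; omega

theorem Core.miss {i : Fin P.n} (hC : E.Core c t m h i ext A k) (he : ∀ j, ext j ≤ 1)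
    (he' : ∀ j : Fin (P.T + 1), j.val < t → ext j = 0)
    (hx : ¬ Hit E.f (bases c) t (E.stream i)) :
    E.Core c t m h (i + 1) 0 A k := by
  refine { hC with p_le := i.2, hits := ?_, le_hits := ?_, tests_lt := ?_, tests_eq := ?_ }
  · rw [E.read_succ]
    simp only [midLevel_insert_of_not_hit hx]
    exact hC.hits
  · have := hC.le_hits
    -- In pass 0 nothing can be missed, so the bound `p ≤ h` is not at risk.
    have ht : t ≠ 0 := fun h0 => hx (Or.inl h0)
    rw [if_neg ht] at this ⊢
    exact this
  · intro j hj hjt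
    have h1 := hC.tests_lt j hj hjt
    rw [he' j hjt] at h1
    exact h1
  · intro j hj hjt
    have h1 := hC.tests_eq j hj hjt
    have h2 := he j
    simp only [Pi.zero_apply]; omega

theorem mem_write_self (i : Fin (P.T + 1)) (N : Finset (Constraint b)) :
    (c.write i N).mem i = N := Function.update_self ..

theorem tests_write_self (i : Fin (P.T + 1)) (N : Finset (Constraint b)) :
    (c.write i N).tests i = 0 := Function.update_self ..

theorem openCost_write (i : Fin (P.T + 1)) (N : Finset (Constraint b)) :
    E.openCost c = E.openCost (c.write i N) + cumCost E.Tv (c.tests i) (c.mem i).card := by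
  unfold openCost
  rw [← Finset.add_sum_erase _ _ (Finset.mem_univ i),
    ← Finset.add_sum_erase (a := i) _ (fun j : Fin (P.T + 1) =>
      cumCost E.Tv ((c.write i N).tests j) ((c.write i N).mem j).card) (Finset.mem_univ i)]
  have h1 : (c.write i N).tests i = 0 := Function.update_self ..
  rw [h1]
  have h2 : ∀ j ∈ Finset.univ.erase i, cumCost E.Tv ((c.write i N).tests j)
      ((c.write i N).mem j).card = cumCost E.Tv (c.tests j) (c.mem j).card := fun j hj => by
    have hne := Finset.ne_of_mem_erase hj
    have a1 : (c.write i N).tests j = c.tests j := Function.update_of_ne hne ..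
    have a2 : (c.write i N).mem j = c.mem j := Function.update_of_ne hne ..
    rw [a1, a2]
  rw [Finset.sum_congr rfl h2]
  simp only [cumCost, if_true, zero_add]
  ring

theorem Core.store (hC : E.Core c t m h p 0 A k) {x : Constraint b} (hx : x ∈ E.S)
    (hm : m + 1 ≤ P.M) :
    E.Core (c.write (0 : Fin (P.T + 1)) (insert x (c.mem (0 : Fin (P.T + 1)))))
      t (m + 1) h p 0 A k := by
  set c' := c.write (0 : Fin (P.T + 1)) (insert x (c.mem (0 : Fin (P.T + 1)))) with hc'
  have hm0 : c'.mem (0 : Fin (P.T + 1)) = insert x (c.mem (0 : Fin (P.T + 1))) :=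
    mem_write_self _ _
  have ht0 : c'.tests (0 : Fin (P.T + 1)) = 0 := tests_write_self _ _
  have hmi : ∀ i : Fin (P.T + 1), i ≠ 0 → c'.mem i = c.mem i := fun i hi =>
    Function.update_of_ne hi ..
  have hti : ∀ i : Fin (P.T + 1), i ≠ 0 → c'.tests i = c.tests i := fun i hi =>
    Function.update_of_ne hi ..
  have hB : ∀ s, s ≤ t → s ≠ 0 → bases c s = bases c' s := fun s hs h0 =>
    (hmi _ (P.slot_ne_zero (hs.trans hC.t_le) h0)).symm
  refine ⟨fun i => ?_, fun i hi => ?_, fun i hi => ?_, hC.peak, ?_, hC.t_le, hm, hC.h_le, hC.p_le,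
    fun s h1 hs => ?_, hC.passes, ?_, hC.le_hits, ht0, fun i hi hit => ?_, fun i hi hit => ?_,
    fun i hi => ?_, ?_⟩
  · by_cases hi : i = 0
    · rw [hi, hm0]; exact Finset.insert_subset hx (hC.sub 0)
    · rw [hmi i hi]; exact hC.sub i
  · rw [hmi i hi]; exact hC.small i hi
  · rw [hmi i hi]; exact hC.fixed i hi
  · rw [hm0]; exact (Finset.card_insert_le _ _).trans (Nat.succ_le_succ hC.card)
  · rw [hm0, ← hB s hs (by omega)]
    -- The sample only grows, so its value stays above those of all stored bases.
    exact (hC.below s h1 hs).trans (E.isMin.mono (Finset.subset_insert _ _)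
      (Finset.insert_subset hx (hC.sub 0)))
  · rw [Finset.sum_congr rfl fun e _ => (midLevel_congr (E.read p) hB e).symm]
    exact hC.hits
  · rw [hti i hi]; exact hC.tests_lt i hi hit
  · rw [hti i hi]; exact hC.tests_eq i hi hit
  · rw [hti i fun h0 => by subst h0; simp at hi]; exact hC.tests_gt i hi
  · have h1 := hC.time
    have h2 := openCost_write (E := E) (c := c) 0 (insert x (c.mem (0 : Fin (P.T + 1))))
    rw [hC.tests_zero, ← hc'] at h2
    have h3 : c'.time = c.time := rfl
    simp only [cumCost, if_true] at h2
    omega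

/-- Closing the count moves the cost of at most `n` tests out of `openCost` and into the settled
budget. Afterwards the slot is tested only when hits are counted. -/
theorem Core.reset (hC : E.Core c t m h P.n 0 A k) (h0 : t ≠ 0) :
    E.Core (c.write (P.slot t) (E.bas (c.mem (P.slot t)))) t m h P.n 0
      (A + E.Tv P.n E.ν) k ∧
    (c.write (P.slot t) (E.bas (c.mem (P.slot t)))).tests (P.slot t) = 0 := by
  set c' := c.write (P.slot t) (E.bas (c.mem (P.slot t))) with hc'
  have hs0 := P.slot_ne_zero hC.t_le h0
  have hmem : c'.mem = c.mem := by
    refine (congrArg (Function.update c.mem (P.slot t)) (hC.fixed _ hs0)).trans ?_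
    exact Function.update_eq_self ..
  have htt : c'.tests (P.slot t) = 0 := Function.update_self ..
  have hti : ∀ i : Fin (P.T + 1), i ≠ P.slot t → c'.tests i = c.tests i := fun i hi =>
    Function.update_of_ne hi ..
  have hB : bases c' = bases c := by unfold bases; rw [hmem]
  have hle : ∀ i : Fin (P.T + 1), c'.tests i ≤ c.tests i := fun i => by
    by_cases hi : i = P.slot t
    · rw [hi, htt]; exact Nat.zero_le _
    · rw [hti i hi]
  refine ⟨⟨?_, ?_, ?_, hC.peak, ?_, hC.t_le, hC.m_le, hC.h_le, hC.p_le, ?_, hC.passes, ?_,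
    hC.le_hits, ?_, fun i hi hit => ?_, fun i hi hit => ?_, fun i hi => ?_, ?_⟩, htt⟩
  · rw [hmem]; exact hC.sub
  · rw [hmem]; exact hC.small
  · rw [hmem]; exact hC.fixed
  · rw [hmem]; exact hC.card
  · rw [hmem, hB]; exact hC.below
  · rw [hB]; exact hC.hits
  · have := hle 0; have := hC.tests_zero; omega
  · have := hle i; have := hC.tests_lt i hi hit; omega
  · exact (hle i).trans (hC.tests_eq i hi hit)
  · have := hle i; have := hC.tests_gt i hi; omega
  · have h1 := hC.time
    have h2 := openCost_write (E := E) (c := c) (P.slot t) (E.bas (c.mem (P.slot t)))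
    rw [← hc'] at h2
    have h3 : c'.time = c.time := rfl
    have h4 : cumCost E.Tv (c.tests (P.slot t)) (c.mem (P.slot t)).card ≤ E.Tv P.n E.ν := by
      unfold cumCost
      split_ifs
      · exact Nat.zero_le _
      · refine E.Tv_mono _ _ _ _ ?_ (hC.small _ hs0)
        exact hC.tests_eq _ hs0 (P.slot_val hC.t_le)
    omega

theorem bases_write_slot {s : ℕ} (hs : s ≤ P.T) (ht : t ≤ P.T) (h : s ≠ t)
    (N : Finset (Constraint b)) : bases (c.write (P.slot t) N) s = bases c s :=
  Function.update_of_ne (P.slot_ne hs ht h) ..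

theorem Core.select (hC : E.Core c t m h P.n 0 A k)
    (h0 : ∀ i : Fin (P.T + 1), i.val = t → c.tests i = 0) (ht : t + 1 ≤ P.T) :
    E.Core (c.write (P.slot (t + 1)) (E.bas (c.mem (0 : Fin (P.T + 1))))) (t + 1) m h 0 0 A k := by
  set c' := c.write (P.slot (t + 1)) (E.bas (c.mem (0 : Fin (P.T + 1)))) with hc'
  have hs0 : P.slot (t + 1) ≠ 0 := P.slot_ne_zero ht (Nat.succ_ne_zero t)
  have hbas := E.bas_spec _ (hC.sub 0)
  have hmt : c'.mem (P.slot (t + 1)) = E.bas (c.mem (0 : Fin (P.T + 1))) :=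
    Function.update_self ..
  have htt : c'.tests (P.slot (t + 1)) = 0 := Function.update_self ..
  have hmi : ∀ i : Fin (P.T + 1), i ≠ P.slot (t + 1) → c'.mem i = c.mem i := fun i hi =>
    Function.update_of_ne hi ..
  have hti : ∀ i : Fin (P.T + 1), i ≠ P.slot (t + 1) → c'.tests i = c.tests i := fun i hi =>
    Function.update_of_ne hi ..
  have hB : ∀ s, s ≤ t → bases c' s = bases c s := fun s hs =>
    bases_write_slot (by omega) ht (by omega) _
  have hn : P.n ≤ h := by simpa using hC.le_hits
  refine ⟨fun i => ?_, fun i hi => ?_, fun i hi => ?_, hC.peak, ?_, ht, hC.m_le, hC.h_le,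
    Nat.zero_le _, fun s h1 hs => ?_, hC.passes.trans (Nat.le_succ _), ?_, ?_, ?_,
    fun i hi hit => ?_, fun i hi hit => ?_, fun i hi => ?_, ?_⟩
  · by_cases hi : i = P.slot (t + 1)
    · rw [hi, hmt]; exact hbas.1.trans (hC.sub 0)
    · rw [hmi i hi]; exact hC.sub i
  · by_cases hi : i = P.slot (t + 1)
    · rw [hi, hmt]; exact (hbas.card_le_combDim (hC.sub 0)).trans E.combDim_le
    · rw [hmi i hi]; exact hC.small i ‹_›
  · by_cases hi : i = P.slot (t + 1)
    · rw [hi, hmt]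
      exact hbas.basis_eq_self (E.bas_spec _ (hbas.1.trans (hC.sub 0)))
    · rw [hmi i hi]; exact hC.fixed i ‹_›
  · rw [hmi 0 hs0.symm]; exact hC.card
  · rw [hmi 0 hs0.symm]
    rcases hs.lt_or_eq with h' | rfl
    · rw [hB s (by omega)]; exact hC.below s h1 (by omega)
    · exact (congrArg E.f hmt).trans hbas.2.1 |>.le
  · refine hC.hits.trans (Finset.sum_le_sum fun e _ => ?_)
    rw [E.read_zero, midLevel_of_not_mem (Finset.notMem_empty e),
      level_congr fun s hs _ => hB s (by omega)]
    exact midLevel_le t _ e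
  · rw [if_neg (Nat.succ_ne_zero t)]; exact hn
  · rw [hti 0 hs0.symm]; exact hC.tests_zero
  · have hne : i ≠ P.slot (t + 1) := fun h' => by
      rw [h', P.slot_val ht] at hit; omega
    rw [hti i hne]
    -- The basis of pass `t` now counts as an old one. Its tests start from zero, and `n ≤ h` holds
    -- because of pass 0.
    rcases (Nat.lt_succ_iff.1 hit).lt_or_eq with h' | h'
    · exact hC.tests_lt i hi h'
    · rw [h0 i h']; simpa using hn
  · have : i = P.slot (t + 1) := Fin.ext (hit.trans (P.slot_val ht).symm)
    rw [this, htt]; exact Nat.zero_le _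
  · have hne : i ≠ P.slot (t + 1) := fun h' => by
      rw [h', P.slot_val ht] at hi; omega
    rw [hti i hne]; exact hC.tests_gt i (by omega)
  · have h1 := hC.time
    have h2 := openCost_write (E := E) (c := c) (P.slot (t + 1))
      (E.bas (c.mem (0 : Fin (P.T + 1))))
    rw [hC.tests_gt (P.slot (t + 1)) (by rw [P.slot_val ht]; omega), ← hc'] at h2
    have h3 : c'.time = c.time := rfl
    simp only [cumCost, if_true] at h2
    omega

end Setting
/-! ### The potential of a configuration -/

namespace Setting

variable {P : Params} {b : ℕ} {R : Type*} [LinearOrder R] (E : Setting P b R)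
  {hw : Fintype.card (P.State b) ≤ 2 ^ P.w}

/-- The invariant of a configuration with control state `q`. -/
def Good (q : Ctrl b) (c : Config (P.machine hw)) : Prop :=
  match q.mode with
  | .scan => E.Core c q.t q.m q.h c.pos 0 (q.t * E.passCost) (P.rank q c.pos) ∧
      c.passes ≤ q.t + if c.pos = 0 then 0 else 1
  | .probe => ∃ i : Fin P.n, c.pos = i + 1 ∧ E.stream i = q.x ∧
      E.Core c q.t q.m q.h i 0 (q.t * E.passCost) (P.rank q c.pos)
  | .count => ∃ (i : Fin P.n) (h : ℕ), c.pos = i + 1 ∧ E.stream i = q.x ∧ q.h = h + 1 ∧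
      h + 1 ≤ 2 * P.n ∧ q.s ≤ q.t ∧ (q.t ≠ 0 → q.s ≠ 0) ∧ Hit E.f (bases c) q.t q.x ∧
      q.v = level E.f (bases c) q.s q.x ∧
      E.Core c q.t q.m h i (fun j => if j = P.slot q.t ∨ j.val < q.s then 1 else 0)
        (q.t * E.passCost) (P.rank q c.pos)
  | .keep => ∃ (i : Fin P.n) (m : ℕ), c.pos = i + 1 ∧ E.stream i = q.x ∧ q.m = m + 1 ∧
      q.m ≤ P.M ∧ E.Core c q.t m q.h (i + 1) 0 (q.t * E.passCost) (P.rank q c.pos)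
  | .refresh => c.pos = 0 ∧ E.Core c q.t q.m q.h P.n 0 (q.t * E.passCost) (P.rank q c.pos)
  | .select => ∃ t, q.t = t + 1 ∧ q.t ≤ P.T ∧ c.pos = 0 ∧
      (∀ i : Fin (P.T + 1), i.val = t → c.tests i = 0) ∧
      E.Core c t q.m q.h P.n 0 (t * E.passCost + E.Tv P.n E.ν + E.Tb P.M) (P.rank q c.pos)
  | .done => E.Final c

open Classical in
/-- The potential of a configuration with control state `q`. -/
noncomputable def phi (q : Ctrl b) (c : Config (P.machine hw)) : ℝ :=
  let A : Finset (Constraint b) := c.mem (0 : Fin (P.T + 1))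
  match q.mode with
  | .scan => E.pot (bases c) A q.t (E.read c.pos) q.m
  | .probe => E.pot (bases c) A q.t (E.read (c.pos - 1)) q.m
  | .count => E.pot (bases c) A q.t (E.read (c.pos - 1)) q.m
  | .keep => E.pot (bases c) (insert q.x A) q.t (E.read c.pos) q.m
  | .refresh => E.pot (bases c) A q.t (E.read P.n) q.m
  | .select => E.pot (bases c) A (q.t - 1) (E.read P.n) q.m
  | .done => if E.f A = E.f E.S then 0 else E.Θ

theorem phi_nonneg (q : Ctrl b) (c : Config (P.machine hw)) : 0 ≤ E.phi q c := by
  unfold phi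
  cases q.mode
  all_goals try exact E.pot_nonneg
  dsimp only
  split_ifs
  · exact le_rfl
  · exact E.Θ_nonneg

/-- What a single step does. -/
def Spec (c : Config (P.machine hw)) : Prop :=
  (∀ c' ∈ ((P.machine hw).step E.f E.bas E.Tv E.Tb E.stream c).support,
    E.Good c'.q.1 c' ∧ (c'.q.1.mode = .done ∨ P.rank c'.q.1 c'.pos < P.rank c.q.1 c.pos)) ∧
  ((P.machine hw).step E.f E.bas E.Tv E.Tb E.stream c).expect
    (fun c' => ENNReal.ofReal (E.phi c'.q.1 c')) ≤ ENNReal.ofReal (E.phi c.q.1 c)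

variable {E} {c : Config (P.machine hw)}

/-! ### One step of the machine in each mode -/

/-- An instruction either continues normally or overflows the registers and stops. Stopping is
harmless if the answer is right or the potential has reached `Θ`. -/
theorem guard_spec {c' : Config (P.machine hw)} {q : Ctrl b} {a : ℕ} {φ : ℝ}
    (hφ : 0 ≤ φ)
    (hb : P.Bounded q → E.Good q (c'.next (P.guard q) a) ∧ E.phi q (c'.next (P.guard q) a) ≤ φ)
    (hnb : ¬ P.Bounded q → E.Final (c'.next (P.guard q) a) ∧
      (E.f (c'.mem (0 : Fin (P.T + 1))) = E.f E.S ∨ E.Θ ≤ φ)) :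
    E.Good (P.guard q).1 (c'.next (P.guard q) a) ∧
    ((P.guard q).1.mode = .done ∨ P.Bounded q ∧ (P.guard q).1 = q) ∧
    E.phi (P.guard q).1 (c'.next (P.guard q) a) ≤ φ := by
  by_cases h : P.Bounded q
  · have h' := hb h
    have hv := P.guard_val h
    generalize P.guard q = q' at h' hv ⊢
    rw [hv]
    exact ⟨h'.1, Or.inr ⟨h, rfl⟩, h'.2⟩
  · have h' := hnb h
    have hv := P.guard_mode h
    generalize P.guard q = q' at h' hv ⊢
    refine ⟨?_, Or.inl hv, ?_⟩
    · unfold Good; rw [hv]; exact h'.1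
    · unfold phi; rw [hv]
      dsimp only
      split_ifs with h''
      · exact hφ
      · exact h'.2.resolve_left h''

theorem spec_of_pure {c' : Config (P.machine hw)} {q : Ctrl b} {a : ℕ}
    (hs : (P.machine hw).step E.f E.bas E.Tv E.Tb E.stream c = PMF.pure (c'.next (P.guard q) a))
    (hb : P.Bounded q → E.Good q (c'.next (P.guard q) a) ∧
      E.phi q (c'.next (P.guard q) a) ≤ E.phi c.q.1 c)
    (hnb : ¬ P.Bounded q → E.Final (c'.next (P.guard q) a) ∧
      (E.f (c'.mem (0 : Fin (P.T + 1))) = E.f E.S ∨ E.Θ ≤ E.phi c.q.1 c))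
    (hr : P.Bounded q → P.rank q c'.pos < P.rank c.q.1 c.pos) : E.Spec c := by
  obtain ⟨h1, h2, h3⟩ := guard_spec (E.phi_nonneg _ _) hb hnb
  unfold Spec
  rw [hs]
  refine ⟨fun d hd => ?_, ?_⟩
  · rw [PMF.mem_support_pure_iff] at hd
    subst hd
    refine ⟨h1, h2.imp_right fun h => ?_⟩
    change P.rank (P.guard q).1 c'.pos < _
    rw [h.2]; exact hr h.1
  · rw [PMF.expect_pure]
    exact ENNReal.ofReal_le_ofReal h3

theorem spec_done (hm : c.q.1.mode = .done) (hG : E.Good c.q.1 c) : E.Spec c := by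
  have hi : (P.machine hw).instr c.q = .halt (0 : Fin (P.T + 1)) := by
    change (P.program c.q.1).map P.guard = _
    unfold Params.program; rw [hm]; rfl
  unfold Spec
  rw [Machine.step_halt hi]
  refine ⟨fun d hd => ?_, ?_⟩
  · rw [PMF.mem_support_pure_iff] at hd
    subst hd
    exact ⟨hG, Or.inl hm⟩
  · rw [PMF.expect_pure]

theorem spec_scan (hm : c.q.1.mode = .scan) (hG : E.Good c.q.1 c) : E.Spec c := by
  have hq := c.q.2
  have hi : (P.machine hw).instr c.q = .read fun o => P.guard (match o with
      | none => { c.q.1 with mode := .refresh }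
      | some x => { c.q.1 with mode := .probe, x := x }) := by
    change (P.program c.q.1).map P.guard = _
    unfold Params.program; rw [hm]
    exact congrArg Instr.read (funext fun o => by cases o <;> rfl)
  have hphi : E.phi c.q.1 c = E.pot (bases c) (c.mem (0 : Fin (P.T + 1))) c.q.1.t
    (E.read c.pos) c.q.1.m := by unfold phi; rw [hm]
  have hrank : P.rank c.q.1 c.pos =
    P.baseRank c.q.1.t c.q.1.h + 4 * (P.n - c.pos) + 4 := by unfold Params.rank; rw [hm]
  unfold Good at hG
  rw [hm] at hG
  obtain ⟨hC, hp⟩ := hG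
  rw [hrank] at hC
  by_cases hpos : c.pos < P.n
  · refine spec_of_pure (Machine.step_read_some hi hpos) (fun _ => ⟨⟨⟨c.pos, hpos⟩, rfl, rfl, ?_⟩, ?_⟩)
      (fun h => absurd hq h) ?_
    · have hC' := hC.setPos (c.pos + 1) (passes := if c.pos = 0 then c.passes + 1 else c.passes)
        (by split_ifs at hp ⊢ <;> omega)
      refine hC'.next _ (j := 0) ?_
      simp only [Params.rank, Config.next]
      omega
    · rw [hphi]; exact le_rfl
    · intro _; rw [hrank]; simp only [Params.rank]; omega
  · have hn : c.pos = P.n := le_antisymm hC.p_le (not_lt.1 hpos)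
    refine spec_of_pure (Machine.step_read_none hi hpos) (fun _ => ⟨⟨rfl, ?_⟩, ?_⟩)
      (fun h => absurd hq h) ?_
    · have hC' := hC.setPos 0 hC.passes
      rw [hn] at hC'
      refine hC'.next _ (j := 0) ?_
      simp only [Params.rank]
      omega
    · rw [hphi, hn]; exact le_rfl
    · intro _; rw [hrank]; simp only [Params.rank]; omega

/-- A hit releases `T + 2` steps, enough to test the constraint against all earlier bases. -/
theorem baseRank_succ {t h : ℕ} (hh : h + 1 ≤ 2 * P.n) :
    P.baseRank t h = P.baseRank t (h + 1) + (P.T + 2) := by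
  unfold Params.baseRank
  obtain ⟨k, hk⟩ := Nat.exists_eq_add_of_le hh
  have h1 : 2 * P.n - h = k + 1 := by omega
  have h2 : 2 * P.n - (h + 1) = k := by omega
  rw [h1, h2]; ring

theorem spec_probe_zero (hm : c.q.1.mode = .probe) (ht : c.q.1.t = 0) (hG : E.Good c.q.1 c) :
    E.Spec c := by
  have hq := c.q.2
  have hi : (P.machine hw).instr c.q = .goto (P.guard
      { c.q.1 with mode := .count, h := c.q.1.h + 1, s := 0, v := 0 }) := by
    change (P.program c.q.1).map P.guard = _
    unfold Params.program; rw [hm]; simp only [ht, if_true]; rfl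
  have hphi : E.phi c.q.1 c = E.pot (bases c) (c.mem (0 : Fin (P.T + 1))) c.q.1.t
    (E.read (c.pos - 1)) c.q.1.m := by unfold phi; rw [hm]
  have hrank : P.rank c.q.1 c.pos =
    P.baseRank c.q.1.t c.q.1.h + 4 * (P.n - c.pos) + 7 := by unfold Params.rank; rw [hm]
  unfold Good at hG
  rw [hm] at hG
  obtain ⟨i, hpos, hx, hC⟩ := hG
  rw [hrank] at hC
  have hhit : Hit E.f (bases c) c.q.1.t (E.stream i) := Or.inl ht
  refine spec_of_pure (Machine.step_goto hi) (fun hb => ?_) (fun hb => ?_) ?_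
  · have hh : c.q.1.h + 1 ≤ 2 * P.n := hb.2.2.1
    refine ⟨⟨i, c.q.1.h, hpos, hx, rfl, hh, Nat.zero_le _, fun h => absurd ht h, Or.inl ht,
      by simp [level], ?_⟩, ?_⟩
    · have hC' : E.Core c c.q.1.t c.q.1.m c.q.1.h i
          (fun j => if j = P.slot c.q.1.t ∨ j.val < 0 then 1 else 0) _ _ :=
        { hC with
          tests_lt := fun j hj hjt => (hC.tests_lt j hj hjt).trans (Nat.le_add_right _ _)
          tests_eq := fun j hj hjt => (hC.tests_eq j hj hjt).trans (Nat.le_add_right _ _) }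
      refine hC'.next _ (j := 0) ?_
      have := baseRank_succ (P := P) (t := c.q.1.t) hh
      simp only [Params.rank, Config.next]
      omega
    · rw [hphi]; exact le_rfl
  · have hC' := (hC.next (P.guard
      { c.q.1 with mode := .count, h := c.q.1.h + 1, s := 0, v := 0 }) (a := 1) (j := 0)
      (k' := 0) (by omega))
    refine ⟨hC'.final (fun _ _ => rfl) (fun _ => i.2.le) ?_, Or.inr ?_⟩
    · rw [ht, zero_mul]; exact Nat.zero_le _
    · have hh : 2 * P.n < c.q.1.h + 1 := by
        by_contra hcon
        exact hb ⟨hq.1, hq.2.1, not_lt.1 hcon, Nat.zero_le _, Nat.zero_le _⟩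
      have h1 := hC.hits
      -- No overflow is possible in pass 0, where each constraint is hit at most once.
      have h2 : ∑ e ∈ E.S, midLevel E.f (bases c) c.q.1.t (E.read i) e ≤
          2 * P.n - P.n := by
        rw [ht]
        calc _ ≤ ∑ e ∈ E.S, 1 := Finset.sum_le_sum fun e _ =>
              (midLevel_le 0 _ e).trans (level_le _ _)
          _ = 2 * P.n - P.n := by rw [Finset.sum_const, smul_eq_mul, mul_one, E.card_S]; omega
      have := E.three_le
      omega
  · intro _
    rw [hrank]
    simp only [Params.rank, ht]
    have : P.baseRank 0 (c.q.1.h + 1) ≤ P.baseRank 0 c.q.1.h :=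
      Nat.add_le_add_left (Nat.mul_le_mul_right _ (by omega)) _
    omega

theorem test_next {t : ℕ} {m h p A k : ℕ} {ext ext' : Fin (P.T + 1) → ℕ}
    (hC : E.Core c t m h p ext A k) {s : ℕ} (h0 : s ≠ 0) (hs : s ≤ t)
    (he : ∀ i, ext' i = ext i + if i = P.slot s then 1 else 0) (q : P.State b) {k' : ℕ}
    (hk : k' + 1 ≤ k) :
    E.Core (Config.next
      { c with tests := Function.update c.tests (P.slot s) (c.tests (P.slot s) + 1) } q
      (1 + testCost E.Tv (c.tests (P.slot s)) (c.mem (P.slot s)).card)) t m h p ext' A k' :=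
  (hC.test h0 hs he).next q (j := 0) (by omega)

theorem spec_probe (hm : c.q.1.mode = .probe) (ht : c.q.1.t ≠ 0) (hG : E.Good c.q.1 c) :
    E.Spec c := by
  have hq := c.q.2
  have hi : (P.machine hw).instr c.q = .test (P.slot c.q.1.t) c.q.1.x fun u => P.guard
      (if u then { c.q.1 with mode := .count, h := c.q.1.h + 1, s := 1, v := 1 }
        else { c.q.1 with mode := .scan }) := by
    change (P.program c.q.1).map P.guard = _
    unfold Params.program; rw [hm]; simp only [ht, if_false]; rfl
  have hphi : E.phi c.q.1 c = E.pot (bases c) (c.mem (0 : Fin (P.T + 1))) c.q.1.t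
    (E.read (c.pos - 1)) c.q.1.m := by unfold phi; rw [hm]
  have hrank : P.rank c.q.1 c.pos =
    P.baseRank c.q.1.t c.q.1.h + 4 * (P.n - c.pos) + 7 := by unfold Params.rank; rw [hm]
  unfold Good at hG
  rw [hm] at hG
  obtain ⟨i, hpos, hx, hC⟩ := hG
  rw [hrank] at hC
  have hT1 : 1 ≤ P.T := E.T_pos
  have hs := Machine.step_test (f := E.f) (bas := E.bas) (Tv := E.Tv) (Tb := E.Tb)
    (stream := E.stream) hi
  by_cases hv : E.f (c.mem (P.slot c.q.1.t)) <
      E.f (insert c.q.1.x (c.mem (P.slot c.q.1.t)))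
  · have hhit : Hit E.f (bases c) c.q.1.t c.q.1.x := Or.inr hv
    rw [decide_eq_true hv] at hs
    refine spec_of_pure hs (fun hb => ?_) (fun hb => ?_) ?_
    · have hh : c.q.1.h + 1 ≤ 2 * P.n := hb.2.2.1
      refine ⟨⟨i, c.q.1.h, hpos, hx, rfl, hh, Nat.one_le_iff_ne_zero.2 ht, fun _ => one_ne_zero,
        hhit, ?_, ?_⟩, ?_⟩
      · exact le_antisymm (level_pos zero_lt_one _) (level_le _ _)
      · have hC' := test_next hC ht le_rfl (ext' := fun j => if j = P.slot c.q.1.t then 1 else 0)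
          (fun j => by simp) (P.guard { c.q.1 with mode := .count, h := c.q.1.h + 1, s := 1, v := 1 })
          (k' := P.rank { c.q.1 with mode := .count, h := c.q.1.h + 1, s := 1, v := 1 } c.pos) (by
            have := baseRank_succ (P := P) (t := c.q.1.t) hh
            have := hC.t_le
            simp only [Params.rank]
            omega)
        exact { hC' with
          tests_lt := fun j hj hjt => (hC'.tests_lt j hj hjt).trans
            (Nat.add_le_add_left (by dsimp only; split_ifs <;> simp_all) _)
          tests_eq := fun j hj hjt => (hC'.tests_eq j hj hjt).trans
            (Nat.add_le_add_left (by dsimp only; split_ifs <;> simp_all) _) }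
      · rw [hphi]; exact le_rfl
    · have hC' := test_next hC ht le_rfl (ext' := fun j => if j = P.slot c.q.1.t then 1 else 0)
          (fun j => by simp) (P.guard { c.q.1 with mode := .count, h := c.q.1.h + 1, s := 1, v := 1 })
          (k' := 0) (by omega)
      have hh : 2 * P.n < c.q.1.h + 1 := by
        by_contra hcon
        exact hb ⟨hq.1, hq.2.1, not_lt.1 hcon, hT1, hT1⟩
      have hA : c.q.1.t * E.passCost ≤ (P.T + 1) * E.passCost :=
        Nat.mul_le_mul_right _ (hC.t_le.trans (Nat.le_succ _))
      refine ⟨hC'.final (fun j hj => ?_) (fun j => ?_) hA, Or.inr ?_⟩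
      · rw [if_neg]; rintro rfl; rw [P.slot_val hC.t_le] at hj; omega
      · have := i.2
        split_ifs <;> omega
      · rw [hphi]
        -- The hit that overflows the counter is not yet part of the potential, so it is counted
        -- with one more constraint read.
        refine E.le_pot_of_hits (D' := E.read (i + 1)) hC.t_le ?_
        rw [← hx] at hhit
        rw [E.read_succ]
        simp only [midLevel_insert_of_hit (E.stream_not_mem_read i) hhit]
        rw [Finset.sum_add_distrib, Finset.sum_ite_eq', if_pos (E.stream_mem i)]
        exact hh.trans_le (Nat.succ_le_succ hC.hits)
    · intro hb
      have hh : c.q.1.h + 1 ≤ 2 * P.n := hb.2.2.1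
      rw [hrank]
      have := baseRank_succ (P := P) (t := c.q.1.t) hh
      have := hC.t_le
      simp only [Params.rank, if_true]
      omega
  · rw [decide_eq_false hv] at hs
    have hhit : ¬ Hit E.f (bases c) c.q.1.t (E.stream i) := by
      rw [hx]; exact fun h => h.elim ht hv
    refine spec_of_pure hs (fun hb => ?_) (fun hb => absurd hq hb) ?_
    · have hC' := (test_next hC ht le_rfl (ext' := fun j => if j = P.slot c.q.1.t then 1 else 0)
          (fun j => by simp) (P.guard { c.q.1 with mode := .scan })
          (k' := P.rank { c.q.1 with mode := .scan } c.pos)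
          (by simp only [Params.rank]; omega)).miss (fun j => by split_ifs <;> simp) (fun j hj => by
            rw [if_neg]; rintro rfl; rw [P.slot_val hC.t_le] at hj; omega) hhit
      rw [← hpos] at hC'
      refine ⟨⟨hC', hC'.passes.trans (le_of_eq ?_)⟩, ?_⟩
      · exact congrArg _ (if_neg (show c.pos ≠ 0 by omega)).symm
      · rw [hphi]
        refine le_of_eq ?_
        have h1 : c.pos - 1 = i := by omega
        rw [h1, ← E.pot_insert_of_not_hit hhit, ← E.read_succ, ← hpos]
        rfl
    · intro _; rw [hrank]; simp only [Params.rank]; simp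

theorem spec_count_test (hm : c.q.1.mode = .count) (hst : c.q.1.s < c.q.1.t)
    (hG : E.Good c.q.1 c) : E.Spec c := by
  have hq := c.q.2
  have hi : (P.machine hw).instr c.q = .test (P.slot c.q.1.s) c.q.1.x fun u => P.guard
      { c.q.1 with mode := .count, s := c.q.1.s + 1, v := c.q.1.v + if u then 1 else 0 } := by
    change (P.program c.q.1).map P.guard = _
    unfold Params.program; rw [hm]; simp only [hst, if_true]; rfl
  have hphi : E.phi c.q.1 c = E.pot (bases c) (c.mem (0 : Fin (P.T + 1))) c.q.1.t
    (E.read (c.pos - 1)) c.q.1.m := by unfold phi; rw [hm]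
  have hrank : P.rank c.q.1 c.pos =
    P.baseRank c.q.1.t c.q.1.h + 4 * (P.n - c.pos) + (c.q.1.t - c.q.1.s) + 6 := by
      unfold Params.rank; rw [hm]
  unfold Good at hG
  rw [hm] at hG
  obtain ⟨i, h, hpos, hx, hh, hh', hs, hs0, hhit, hv, hC⟩ := hG
  rw [hrank] at hC
  have ht := hC.t_le
  have hs1 : c.q.1.s ≠ 0 := hs0 (by omega)
  have hv' : c.q.1.v ≤ c.q.1.s := hv ▸ level_le _ _
  have hslot := P.slot_ne (hs.trans ht) ht hst.ne
  have hstep := Machine.step_test (f := E.f) (bas := E.bas) (Tv := E.Tv) (Tb := E.Tb)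
    (stream := E.stream) hi
  refine spec_of_pure hstep (fun hb => ?_) (fun hb => ?_) ?_
  · refine ⟨⟨i, h, hpos, hx, hh, hh', hst, fun _ => Nat.succ_ne_zero _, hhit, ?_, ?_⟩, ?_⟩
    · classical
      refine Eq.trans ?_ (level_succ _ _).symm
      refine congrArg₂ _ hv ?_
      have : Hit E.f (bases c) c.q.1.s c.q.1.x ↔ E.f (c.mem
          (P.slot c.q.1.s)) < E.f (insert c.q.1.x (c.mem (P.slot c.q.1.s))) :=
        or_iff_right hs1
      simp only [decide_eq_true_eq, ← this]
      rfl
    · refine test_next hC hs1 hst.le (fun j => ?_) _ ?_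
      · by_cases hj : j = P.slot c.q.1.s
        · subst hj
          rw [if_pos (Or.inr (by rw [P.slot_val (hs.trans ht)]; exact Nat.lt_succ_self _)),
            if_neg (by rw [P.slot_val (hs.trans ht)]; exact fun h => h.elim hslot (lt_irrefl _)),
            if_pos rfl]
        · have hjs : j.val ≠ c.q.1.s := fun h =>
            hj (Fin.ext (h.trans (P.slot_val (hs.trans ht)).symm))
          rw [if_neg hj, add_zero]
          refine if_congr (or_congr_right ?_) rfl rfl
          dsimp only
          omega
      · simp only [Params.rank, Config.next]
        omega
    · rw [hphi]; exact le_rfl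
  · refine absurd ⟨hq.1, hq.2.1, hq.2.2.1, hst.trans_le ht, ?_⟩ hb
    dsimp only
    split_ifs <;> omega
  · intro _
    rw [hrank]
    simp only [Params.rank]
    omega

theorem spec_count_random (hm : c.q.1.mode = .count) (hst : ¬ c.q.1.s < c.q.1.t)
    (hG : E.Good c.q.1 c) : E.Spec c := by
  have hq := c.q.2
  obtain ⟨g, hg⟩ : ∃ g : Fin (2 ^ P.w) → Ctrl b, ∀ z, g z =
      if z.val * P.n < 2 ^ P.w * (P.q * P.β ^ c.q.1.v) then
        { c.q.1 with mode := .keep, m := c.q.1.m + 1 } else { c.q.1 with mode := .scan } :=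
    ⟨_, fun _ => rfl⟩
  have hi : (P.machine hw).instr c.q = .random fun z => P.guard (g z) := by
    change (P.program c.q.1).map P.guard = _
    unfold Params.program; rw [hm]; simp only [hst, if_false, hg]; rfl
  have hphi : E.phi c.q.1 c = E.pot (bases c) (c.mem (0 : Fin (P.T + 1))) c.q.1.t
    (E.read (c.pos - 1)) c.q.1.m := by unfold phi; rw [hm]
  have hrank : P.rank c.q.1 c.pos =
    P.baseRank c.q.1.t c.q.1.h + 4 * (P.n - c.pos) + (c.q.1.t - c.q.1.s) + 6 := by
      unfold Params.rank; rw [hm]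
  unfold Good at hG
  rw [hm] at hG
  obtain ⟨i, h, hpos, hx, hh, hh', hs, hs0, hhit, hv, hC⟩ := hG
  rw [hrank] at hC
  have ht := hC.t_le
  have hst' : c.q.1.s = c.q.1.t := le_antisymm hs (not_lt.1 hst)
  rw [hst'] at hv
  rw [← hx] at hhit hv
  -- The hit was entered in the register when it was detected; the invariant records it only here,
  -- once all the tests it has to pay for are done.
  have hC := hC.hit (fun j => by split_ifs <;> simp) hhit hh'
  rw [← hh] at hC
  have hsample := E.pot_sample_le (B := bases c) (A := c.mem (0 : Fin (P.T + 1)))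
    (m := c.q.1.m) (E.stream_mem i) (E.stream_not_mem_read i) hhit
  rw [← E.read_succ, ← hv] at hsample
  have key : ∀ z, E.Good (P.guard (g z)).1 (c.next (P.guard (g z)) 1) ∧
      ((P.guard (g z)).1.mode = .done ∨ P.Bounded (g z) ∧ (P.guard (g z)).1 = g z) ∧
      E.phi (P.guard (g z)).1 (c.next (P.guard (g z)) 1) ≤
      if z.val * P.n < 2 ^ P.w * (P.q * P.β ^ c.q.1.v) then
        E.pot (bases c) (insert (E.stream i) (c.mem (0 : Fin (P.T + 1)))) c.q.1.t
          (E.read (i + 1)) (c.q.1.m + 1)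
        else E.pot (bases c) (c.mem (0 : Fin (P.T + 1))) c.q.1.t (E.read (i + 1)) c.q.1.m := by
    intro z
    rw [hg z]
    split_ifs with hz
    · refine guard_spec E.pot_nonneg (fun hb => ?_) (fun hb => ?_)
      · refine ⟨⟨i, c.q.1.m, hpos, hx, rfl, hb.2.1, hC.next _ (j := 0) ?_⟩, ?_⟩
        · simp only [Params.rank, Config.next]; omega
        · rw [← hpos, hx]; exact le_rfl
      · have hC' := hC.next (P.guard { c.q.1 with mode := .keep, m := c.q.1.m + 1 })
          (a := 1) (j := 0) (k' := 0) (by omega)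
        refine ⟨hC'.final (fun _ _ => rfl) (fun _ => hC.p_le)
          (Nat.mul_le_mul_right _ (ht.trans (Nat.le_succ _))), Or.inr ?_⟩
        refine E.le_pot_of_size ht ?_
        by_contra hcon
        exact hb ⟨hq.1, not_lt.1 hcon, hq.2.2⟩
    · refine guard_spec E.pot_nonneg (fun hb => ?_) (fun hb => absurd hq hb)
      have hC' := hC.next (P.guard { c.q.1 with mode := .scan }) (a := 1) (j := 0)
        (k' := P.rank { c.q.1 with mode := .scan } c.pos)
        (by simp only [Params.rank]; omega)
      rw [← hpos] at hC' ⊢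
      exact ⟨⟨hC', hC'.passes.trans (le_of_eq
        (congrArg _ (if_neg (show c.pos ≠ 0 by omega)).symm))⟩, le_rfl⟩
  unfold Spec
  rw [Machine.step_random hi]
  refine ⟨fun d hd => ?_, ?_⟩
  · obtain ⟨z, _, rfl⟩ := (PMF.mem_support_map_iff _ _ _).1 hd
    refine ⟨(key z).1, (key z).2.1.imp_right fun h => ?_⟩
    refine lt_of_eq_of_lt (congrArg (fun q => P.rank q c.pos) h.2) ?_
    rw [hrank, hg z]
    split_ifs
    all_goals simp only [Params.rank]; omega
  · have : NeZero (2 ^ P.w) := ⟨(Nat.two_pow_pos _).ne'⟩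
    refine (expect_coin (N := 2 ^ P.w) (n := P.n) (a := P.q * P.β ^ c.q.1.v)
      (fun z => c.next (P.guard (g z)) 1)
      (Φ := fun c' : Config (P.machine hw) => ENNReal.ofReal (E.phi c'.q.1 c')) E.pot_nonneg
      E.pot_nonneg fun z => ENNReal.ofReal_le_ofReal (key z).2.2).trans ?_
    refine ENNReal.ofReal_le_ofReal (hsample.trans (le_of_eq ?_))
    rw [hphi, hpos]; rfl

theorem spec_keep (hm : c.q.1.mode = .keep) (hG : E.Good c.q.1 c) : E.Spec c := by
  have hq := c.q.2
  have hi : (P.machine hw).instr c.q = .store (0 : Fin (P.T + 1)) c.q.1.x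
      (P.guard { c.q.1 with mode := .scan }) := by
    change (P.program c.q.1).map P.guard = _
    unfold Params.program; rw [hm]; rfl
  have hphi : E.phi c.q.1 c = E.pot (bases c) (insert c.q.1.x (c.mem (0 : Fin (P.T + 1))))
    c.q.1.t (E.read c.pos) c.q.1.m := by unfold phi; rw [hm]
  have hrank : P.rank c.q.1 c.pos =
    P.baseRank c.q.1.t c.q.1.h + 4 * (P.n - c.pos) + 5 := by unfold Params.rank; rw [hm]
  unfold Good at hG
  rw [hm] at hG
  obtain ⟨i, m, hpos, hx, hmm, hmM, hC⟩ := hG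
  rw [hrank] at hC
  have hxS : c.q.1.x ∈ E.S := hx ▸ E.stream_mem i
  refine spec_of_pure (Machine.step_store hi) (fun _ => ?_) (fun hb => absurd hq hb) ?_
  · have hC' := (hC.store hxS (by omega)).next (P.guard { c.q.1 with mode := .scan })
      (a := 1) (j := 0) (k' := P.rank { c.q.1 with mode := .scan } c.pos)
        (by simp only [Params.rank]; omega)
    rw [← hmm, ← hpos] at hC'
    refine ⟨⟨hC', hC'.passes.trans (le_of_eq
        (congrArg _ (if_neg (show c.pos ≠ 0 by omega)).symm))⟩, ?_⟩
    rw [hphi]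
    refine le_of_eq ?_
    have hmem : (c.write (0 : Fin (P.T + 1)) (insert c.q.1.x (c.mem (0 : Fin (P.T + 1))))).mem
        (0 : Fin (P.T + 1)) = insert c.q.1.x (c.mem (0 : Fin (P.T + 1))) := mem_write_self _ _
    refine (E.pot_congr (fun s hs h0 => ?_)).trans (congrArg
      (fun A => E.pot (bases c) A c.q.1.t (E.read c.pos) c.q.1.m) hmem)
    exact Function.update_of_ne (P.slot_ne_zero (hs.trans hC.t_le) h0) ..
  · intro _
    rw [hrank]; simp only [Params.rank]
    exact Nat.lt_succ_self _

theorem baseRank_pass {t h : ℕ} (ht : t + 1 ≤ P.T) :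
    P.baseRank t h = P.baseRank (t + 1) h + (4 * P.n + 6) := by
  unfold Params.baseRank
  obtain ⟨k, hk⟩ := Nat.exists_eq_add_of_le ht
  have h1 : P.T - t = k + 1 := by omega
  have h2 : P.T - (t + 1) = k := by omega
  rw [h1, h2]; ring

/-- The value of the sample bounds those of all stored bases, so if it is below `f S`, none of the
`T` bases succeeded. -/
theorem Core.eq_or_le_pot {t m h p A k m' : ℕ} {ext : Fin (P.T + 1) → ℕ}
    {D : Finset (Constraint b)} (hC : E.Core c t m h p ext A k) (ht : t = P.T) :
    E.f (c.mem (0 : Fin (P.T + 1))) = E.f E.S ∨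
      E.Θ ≤ E.pot (bases c) (c.mem (0 : Fin (P.T + 1))) t D m' := by
  rcases (E.isMin.mono (hC.sub 0) subset_rfl).lt_or_eq with hlt | heq
  · subst ht
    exact Or.inr (E.le_pot_of_ne (fun s _ _ => hC.sub _)
      fun s h1 hs => (hC.below s h1 hs).trans_lt hlt)
  · exact Or.inl heq

theorem spec_refresh (hm : c.q.1.mode = .refresh) (hG : E.Good c.q.1 c) : E.Spec c := by
  have hq := c.q.2
  have hphi : E.phi c.q.1 c = E.pot (bases c) (c.mem (0 : Fin (P.T + 1)))
    c.q.1.t (E.read P.n) c.q.1.m := by unfold phi; rw [hm]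
  have hrank : P.rank c.q.1 c.pos = P.baseRank c.q.1.t c.q.1.h + 3 := by
    unfold Params.rank; rw [hm]
  unfold Good at hG
  rw [hm] at hG
  obtain ⟨hpos, hC⟩ := hG
  rw [hrank] at hC
  have hT := E.T_pos
  have hr : P.Bounded { c.q.1 with mode := .select, t := c.q.1.t + 1 } →
      P.rank { c.q.1 with mode := .select, t := c.q.1.t + 1 } c.pos + 3 = P.rank c.q.1 c.pos := by
    intro hb
    have := baseRank_pass (h := c.q.1.h) hb.1
    rw [hrank]
    simp only [Params.rank]
    omega
  have hbig : ¬ P.Bounded { c.q.1 with mode := .select, t := c.q.1.t + 1 } → c.q.1.t = P.T := by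
    intro hb
    by_contra hne
    exact hb ⟨lt_of_le_of_ne hq.1 hne, hq.2⟩
  by_cases ht : c.q.1.t = 0
  · have hi : (P.machine hw).instr c.q = .goto
        (P.guard { c.q.1 with mode := .select, t := c.q.1.t + 1 }) := by
      change (P.program c.q.1).map P.guard = _
      unfold Params.program; rw [hm]; simp only [ht, if_true]; rfl
    refine spec_of_pure (Machine.step_goto hi) (fun hb => ?_) (fun hb => ?_) ?_
    · refine ⟨⟨c.q.1.t, rfl, hb.1, hpos, fun j hj => ?_, ?_⟩, ?_⟩
      · have : j = 0 := Fin.ext (hj.trans ht)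
        rw [this]; exact hC.tests_zero
      · have := hr hb
        rw [add_assoc]
        exact hC.next _ (by change _ + P.rank { c.q.1 with mode := .select, t := c.q.1.t + 1 } c.pos ≤ _; omega)
      · rw [hphi]; exact le_rfl
    · have := hbig hb; omega
    · intro hb
      have := hr hb
      omega
  · have hi : (P.machine hw).instr c.q = .basis (P.slot c.q.1.t) (P.slot c.q.1.t)
        (P.guard { c.q.1 with mode := .select, t := c.q.1.t + 1 }) := by
      change (P.program c.q.1).map P.guard = _
      unfold Params.program; rw [hm]; simp only [ht, if_false]; rfl
    obtain ⟨hC', htest⟩ := hC.reset ht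
    have hcost : E.Tb (c.mem (P.slot c.q.1.t)).card ≤ E.Tb P.M :=
      E.Tb_mono ((hC.small _ (P.slot_ne_zero hC.t_le ht)).trans E.ν_le)
    refine spec_of_pure (Machine.step_basis hi) (fun hb => ?_) (fun hb => ?_) ?_
    · refine ⟨⟨c.q.1.t, rfl, hb.1, hpos, fun j hj => ?_, ?_⟩, ?_⟩
      · have : j = P.slot c.q.1.t := Fin.ext (hj.trans (P.slot_val hC.t_le).symm)
        rw [this]; exact htest
      · have := hr hb
        exact hC'.next _ (by
          change _ + P.rank { c.q.1 with mode := .select, t := c.q.1.t + 1 } c.pos ≤ _; omega)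
      · rw [hphi]
        have hmem : (c.write (P.slot c.q.1.t) (E.bas (c.mem (P.slot c.q.1.t)))).mem = c.mem := by
          refine (congrArg (Function.update c.mem (P.slot c.q.1.t))
            (hC.fixed _ (P.slot_ne_zero hC.t_le ht))).trans ?_
          exact Function.update_eq_self ..
        refine le_of_eq ?_
        exact congrArg (fun μ : Fin (P.T + 1) → Finset (Constraint b) =>
          E.pot (fun s => μ (P.slot s)) (μ 0) c.q.1.t (E.read P.n) c.q.1.m) hmem
    -- Overflow of the pass number is the regular end of a run.
    · have htT := hbig hb
      refine ⟨(hC'.next (P.guard { c.q.1 with mode := .select, t := c.q.1.t + 1 }) (k' := 0)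
        (a := 1 + E.Tb (c.mem (P.slot c.q.1.t)).card) (j := E.Tb P.M) (by omega)).final
        (fun _ _ => rfl) (fun _ => le_rfl) ?_, ?_⟩
      · rw [htT, add_mul, one_mul]
        have : E.passCost = E.Tv P.n E.ν + 2 * E.Tb P.M := rfl
        omega
      · rw [hphi]
        refine (hC.eq_or_le_pot htT).imp_left fun h => ?_
        refine Eq.trans (congrArg E.f ?_) h
        exact Function.update_of_ne (P.slot_ne_zero hC.t_le ht).symm ..
    · intro hb
      have := hr hb
      change P.rank { c.q.1 with mode := .select, t := c.q.1.t + 1 } c.pos < _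
      omega

theorem spec_select (hm : c.q.1.mode = .select) (hG : E.Good c.q.1 c) : E.Spec c := by
  have hq := c.q.2
  have hi : (P.machine hw).instr c.q = .basis (0 : Fin (P.T + 1)) (P.slot c.q.1.t)
        (P.guard { c.q.1 with mode := .scan }) := by
      change (P.program c.q.1).map P.guard = _
      unfold Params.program; rw [hm]; rfl
  have hphi : E.phi c.q.1 c = E.pot (bases c) (c.mem (0 : Fin (P.T + 1)))
    (c.q.1.t - 1) (E.read P.n) c.q.1.m := by unfold phi; rw [hm]
  have hrank : P.rank c.q.1 c.pos = P.baseRank c.q.1.t c.q.1.h + (4 * P.n + 6) := by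
    unfold Params.rank; rw [hm]
  unfold Good at hG
  rw [hm] at hG
  obtain ⟨t, ht, htT, hpos, htests, hC⟩ := hG
  rw [hrank] at hC
  have hcost : E.Tb (c.mem (0 : Fin (P.T + 1))).card ≤ E.Tb P.M :=
    E.Tb_mono (hC.card.trans hC.m_le)
  rw [ht] at htT
  have hsel := hC.select htests htT
  have hold : ∀ s, s ≤ t → s ≠ 0 → bases c s =
      bases (c.write (P.slot (t + 1)) (E.bas (c.mem (0 : Fin (P.T + 1))))) s :=
    fun s hs _ => (bases_write_slot (by omega) htT (by omega) _).symm
  have hpot := E.pot_select_le (m := c.q.1.m) (hC.sub 0) hold (mem_write_self _ _)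
  have h0 : (c.write (P.slot (t + 1)) (E.bas (c.mem (0 : Fin (P.T + 1))))).mem
      (0 : Fin (P.T + 1)) = c.mem (0 : Fin (P.T + 1)) :=
    Function.update_of_ne (P.slot_ne_zero htT (Nat.succ_ne_zero t)).symm ..
  have hread : E.read c.pos = ∅ := by rw [hpos, E.read_zero]
  -- A pass settles the tests against its own basis and two basis computations, one for the reset
  -- and one for the sample.
  have hA : t * E.passCost + E.Tv P.n E.ν + E.Tb P.M + E.Tb P.M = (t + 1) * E.passCost := by
    have : E.passCost = E.Tv P.n E.ν + 2 * E.Tb P.M := rfl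
    rw [add_mul, one_mul]; omega
  rw [← hread] at hpot
  rw [← ht] at hsel hpot h0 hA
  refine spec_of_pure (Machine.step_basis hi) (fun _ => ?_) (fun hb => absurd hq hb) ?_
  · have hC' := hsel.next (P.guard { c.q.1 with mode := .scan })
      (a := 1 + E.Tb (c.mem (0 : Fin (P.T + 1))).card) (j := E.Tb P.M)
      (k' := P.rank { c.q.1 with mode := .scan } c.pos)
        (by simp only [Params.rank]; omega)
    rw [hA] at hC'
    have hC'' : ∀ p, p = 0 → E.Core ((c.write (P.slot c.q.1.t)
        (E.bas (c.mem (0 : Fin (P.T + 1))))).next (P.guard { c.q.1 with mode := .scan })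
        (1 + E.Tb (c.mem (0 : Fin (P.T + 1))).card)) c.q.1.t c.q.1.m c.q.1.h p 0
        (c.q.1.t * E.passCost) (P.rank { c.q.1 with mode := .scan } c.pos) := by
      rintro _ rfl; exact hC'
    refine ⟨⟨hC'' c.pos hpos, ?_⟩, ?_⟩
    · refine le_trans ?_ (Nat.le_add_right _ _)
      refine le_trans ?_ ht.ge
      exact hC.passes
    · rw [hphi, show c.q.1.t - 1 = t by omega]
      refine le_trans (le_of_eq ?_) hpot
      exact congrArg (fun A => E.pot (bases (c.write (P.slot c.q.1.t)
        (E.bas (c.mem (0 : Fin (P.T + 1)))))) A c.q.1.t (E.read c.pos) c.q.1.m) h0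
  · intro _
    rw [hrank]
    simp only [Params.rank, Config.write]
    omega

theorem spec_of_good (hG : E.Good c.q.1 c) : E.Spec c := by
  cases hm : c.q.1.mode with
  | scan => exact spec_scan hm hG
  | probe =>
    by_cases ht : c.q.1.t = 0
    · exact spec_probe_zero hm ht hG
    · exact spec_probe hm ht hG
  | count =>
    by_cases hs : c.q.1.s < c.q.1.t
    · exact spec_count_test hm hs hG
    · exact spec_count_random hm hs hG
  | keep => exact spec_keep hm hG
  | refresh => exact spec_refresh hm hG
  | select => exact spec_select hm hG
  | done => exact spec_done hm hG

end Setting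
/-! ### Runs -/

namespace Setting

variable {P : Params} {b : ℕ} {R : Type*} [LinearOrder R] (E : Setting P b R)
  (hw : Fintype.card (P.State b) ≤ 2 ^ P.w)

theorem good_init : E.Good P.start.1 (P.machine hw).init := by
  have hbas : E.bas ∅ = ∅ := Finset.subset_empty.1 (E.bas_spec ∅ (Finset.empty_subset _)).1
  refine ⟨?_, Nat.zero_le _⟩
  exact
    { sub := fun _ => Finset.empty_subset _
      small := fun _ _ => Nat.zero_le _
      fixed := fun _ _ => hbas
      peak := Nat.add_le_add_left (Nat.mul_le_mul_left _ (Nat.le_add_right _ _)) _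
      card := le_rfl
      t_le := Nat.zero_le _
      m_le := Nat.zero_le _
      h_le := Nat.zero_le _
      p_le := Nat.zero_le _
      below := fun s h1 h2 => absurd (h1.trans h2) (by simp [Params.start])
      passes := Nat.zero_le _
      hits := Nat.zero_le _
      le_hits := le_rfl
      tests_zero := rfl
      tests_lt := fun i _ h => absurd h (Nat.not_lt_zero _)
      tests_eq := fun _ _ _ => Nat.zero_le _
      tests_gt := fun _ _ => rfl
      time := by
        have h1 : P.rank (P.start (b := b)).1 0 = P.steps := rfl
        have h2 : ((P.machine hw).init : Config (P.machine hw)).time = 0 := rfl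
        have h3 : ((P.machine hw).init : Config (P.machine hw)).pos = 0 := rfl
        rw [h3, h1, h2]
        omega }

theorem phi_init : E.phi P.start.1 (P.machine hw).init = (exclusionFamily E.S E.K).card + 1 := by
  have h1 : E.phi P.start.1 (P.machine hw).init =
      E.pot (bases (P.machine hw).init) ∅ 0 (E.read 0) 0 := rfl
  rw [h1, E.pot_of_not_heavy (by rintro ⟨s, h1, h2, -⟩; omega), E.read_zero]
  refine potential_zero (fun e _ => ?_) fun V hV => E.subset_of_mem_family hV
  rw [midLevel_of_not_mem (Finset.notMem_empty e)]
  simp [level, load]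

theorem run_good (k : ℕ) :
    ∀ z ∈ ((P.machine hw).run E.f E.bas E.Tv E.Tb E.stream k).support,
      E.Good z.q.1 z ∧ (z.q.1.mode = .done ∨ P.rank z.q.1 z.pos + k ≤ P.steps) := by
  induction k with
  | zero =>
    intro z hz
    rw [Machine.run, PMF.mem_support_pure_iff] at hz
    subst hz
    exact ⟨E.good_init hw, Or.inr le_rfl⟩
  | succ k ih =>
    intro z hz
    rw [Machine.run, PMF.mem_support_bind_iff] at hz
    obtain ⟨y, hy, hz⟩ := hz
    obtain ⟨hG, hr⟩ := ih y hy
    obtain ⟨h1, h2⟩ := (spec_of_good hG).1 z hz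
    refine ⟨h1, h2.imp_right fun h => ?_⟩
    rcases hr with hd | hr
    · have : P.rank y.q.1 y.pos = 0 := by unfold Params.rank; rw [hd]
      omega
    · omega

theorem run_expect (k : ℕ) :
    ((P.machine hw).run E.f E.bas E.Tv E.Tb E.stream k).expect
      (fun z => ENNReal.ofReal (E.phi z.q.1 z)) ≤
      ENNReal.ofReal ((exclusionFamily E.S E.K).card + 1) := by
  induction k with
  | zero =>
    rw [Machine.run, PMF.expect_pure, ← E.phi_init hw]
    exact le_rfl
  | succ k ih =>
    rw [Machine.run, PMF.expect_bind]
    exact (PMF.expect_mono fun y hy => (spec_of_good (E.run_good hw k y hy).1).2).trans ih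

/-- The machine stops, within the bounds, and fails with probability at most `δ`. -/
theorem run_steps {δ : ℝ} (hΘ : 0 < E.Θ)
    (hδ : ((exclusionFamily E.S E.K).card + 1 : ℝ) ≤ δ * E.Θ) :
    (∀ z ∈ ((P.machine hw).run E.f E.bas E.Tv E.Tb E.stream (P.steps + 1)).support,
      (∃ A, z.Outputs A) ∧ E.Final z) ∧
    ENNReal.ofReal (1 - δ) ≤
      ((P.machine hw).run E.f E.bas E.Tv E.Tb E.stream (P.steps + 1)).toOuterMeasure
        {z | ∃ A, z.Outputs A ∧ E.f A = E.f E.S} := by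
  -- The rank would have to be negative after `P.steps + 1` steps.
  have hdone : ∀ z ∈ ((P.machine hw).run E.f E.bas E.Tv E.Tb E.stream (P.steps + 1)).support,
      z.q.1.mode = .done := fun z hz => by
    rcases (E.run_good hw _ z hz).2 with h | h
    · exact h
    · omega
  have hout : ∀ z ∈ ((P.machine hw).run E.f E.bas E.Tv E.Tb E.stream (P.steps + 1)).support,
      z.Outputs (z.mem (0 : Fin (P.T + 1))) := fun z hz => by
    refine ⟨(0 : Fin (P.T + 1)), ?_, rfl⟩
    change (P.program z.q.1).map P.guard = _
    unfold Params.program; rw [hdone z hz]; rfl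
  refine ⟨fun z hz => ⟨⟨_, hout z hz⟩, ?_⟩, ?_⟩
  · have hG := (E.run_good hw _ z hz).1
    unfold Good at hG
    rw [hdone z hz] at hG
    exact hG
  · refine le_trans ?_ (PMF.one_sub_le_toOuterMeasure
      (Φ := fun z => ENNReal.ofReal (E.phi z.q.1 z)) (Θ := ENNReal.ofReal E.Θ)
      (by simpa using hΘ) ENNReal.ofReal_ne_top fun z hz hzG => ?_)
    · have hδ0 : 0 ≤ δ := by
        by_contra hneg
        have := mul_neg_of_neg_of_pos (not_le.1 hneg) hΘ
        have h0 : (0 : ℝ) ≤ (exclusionFamily E.S E.K).card := Nat.cast_nonneg _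
        linarith
      rw [ENNReal.ofReal_sub _ hδ0, ENNReal.ofReal_one]
      refine tsub_le_tsub_left (ENNReal.div_le_of_le_mul ?_) _
      rw [← ENNReal.ofReal_mul hδ0]
      exact (E.run_expect hw _).trans (ENNReal.ofReal_le_ofReal hδ)
    · refine ENNReal.ofReal_le_ofReal ?_
      unfold phi
      rw [hdone z hz]
      dsimp only
      rw [if_neg fun h => hzG ⟨_, hout z hz, h⟩]

end Setting

/-! ### The trivial machine -/

/-- The machine that stops at once. -/
def haltMachine (b : ℕ) : Machine b where
  w := 0
  slots := 1
  Q := Unit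
  fintypeQ := inferInstance
  card_le := by simp
  start := ()
  instr := fun _ => .halt 0

/-! ### The choice of the parameters -/

section Parameters

variable (n ν vc r a d b : ℕ)

/-- The growth factor `⌈n ^ (1 / r)⌉`. -/
noncomputable def growth : ℕ := ⌈(n : ℝ) ^ ((1 : ℝ) / r)⌉₊

/-- The expected size of the first sample. -/
noncomputable def sampleSize : ℕ :=
  ⌈((ν * (2 * r) : ℕ) : ℝ) * growth n r * (((2 * vc + 1 + a : ℕ) : ℝ) * Real.log n)⌉₊

/-- The parameters of the reweighting machine with `d * b` bits of registers. -/
noncomputable def mkParams : Params where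
  n := n
  T := ν * (2 * r)
  -- `8q` offsets the size term of the potential at total load `2n`; the remaining `q` exceeds the
  -- logarithm of `Θ`.
  M := 9 * sampleSize n ν vc r a
  q := sampleSize n ν vc r a
  β := growth n r
  w := d * b

variable {n ν vc r a d b}

theorem three_le_of_log (hr : 1 ≤ r) (h : (r : ℝ) ≤ Real.log n) : 3 ≤ n := by
  by_contra! hn
  have hr' : (1 : ℝ) ≤ r := by exact_mod_cast hr
  have h1 : Real.log n ≤ Real.log 2 := by
    rcases Nat.eq_zero_or_pos n with rfl | h0
    · simp [Real.log_nonneg]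
    · exact Real.log_le_log (by exact_mod_cast h0) (by exact_mod_cast (by omega : n ≤ 2))
  have := Real.log_two_lt_d9
  linarith

theorem one_le_rpow (hn : 1 ≤ n) : 1 ≤ (n : ℝ) ^ ((1 : ℝ) / r) :=
  Real.one_le_rpow (by exact_mod_cast hn) (by positivity)

theorem one_le_growth (hn : 1 ≤ n) : 1 ≤ growth n r :=
  Nat.one_le_ceil_iff.2 (lt_of_lt_of_le one_pos (one_le_rpow hn))

theorem le_growth_pow (hr : 1 ≤ r) : n ≤ growth n r ^ r := by
  have h1 : ((n : ℝ) ^ ((1 : ℝ) / r)) ^ r = n := by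
    rw [← Real.rpow_natCast, ← Real.rpow_mul (Nat.cast_nonneg _), one_div,
      inv_mul_cancel₀ (by exact_mod_cast (by omega : r ≠ 0)), Real.rpow_one]
  have h2 : ((n : ℝ) ^ ((1 : ℝ) / r)) ^ r ≤ (growth n r : ℝ) ^ r :=
    pow_le_pow_left₀ (by positivity) (Nat.le_ceil _) r
  rw [h1] at h2
  exact_mod_cast h2

theorem growth_le_two_mul (hn : 1 ≤ n) :
    (growth n r : ℝ) ≤ 2 * (n : ℝ) ^ ((1 : ℝ) / r) := by
  have h1 := Nat.ceil_lt_add_one (a := (n : ℝ) ^ ((1 : ℝ) / r)) (by positivity)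
  have h2 := one_le_rpow (r := r) hn
  unfold growth
  linarith

theorem growth_le (hn : 1 ≤ n) (hr : 1 ≤ r) : growth n r ≤ n := by
  refine Nat.ceil_le.2 ?_
  calc (n : ℝ) ^ ((1 : ℝ) / r) ≤ (n : ℝ) ^ (1 : ℝ) :=
        Real.rpow_le_rpow_of_exponent_le (by exact_mod_cast hn) (by
          rw [div_le_one (by exact_mod_cast hr)]; exact_mod_cast hr)
    _ = n := Real.rpow_one _

theorem sampleSize_le (hν : 1 ≤ ν) (hr : 1 ≤ r) (hlog : (r : ℝ) ≤ Real.log n) :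
    (sampleSize n ν vc r a : ℝ) ≤
      2 * (((ν * (2 * r) : ℕ) : ℝ) * growth n r * (((2 * vc + 1 + a : ℕ) : ℝ) * Real.log n)) := by
  have hn := three_le_of_log hr hlog
  have h1 : (1 : ℝ) ≤ ((ν * (2 * r) : ℕ) : ℝ) := by
    exact_mod_cast Nat.mul_pos hν (by omega)
  have h2 : (1 : ℝ) ≤ growth n r := by exact_mod_cast one_le_growth (by omega)
  have h3 : (1 : ℝ) ≤ ((2 * vc + 1 + a : ℕ) : ℝ) := by exact_mod_cast (by omega)
  have h4 : (1 : ℝ) ≤ Real.log n := le_trans (by exact_mod_cast hr) hlog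
  have h5 := one_le_mul_of_one_le_of_one_le (one_le_mul_of_one_le_of_one_le h1 h2)
    (one_le_mul_of_one_le_of_one_le h3 h4)
  have h6 := (Nat.ceil_lt_add_one (zero_le_one.trans h5)).le
  unfold sampleSize
  linarith

theorem le_sampleSize : ((ν * (2 * r) : ℕ) : ℝ) * growth n r *
    (((2 * vc + 1 + a : ℕ) : ℝ) * Real.log n) ≤ sampleSize n ν vc r a := Nat.le_ceil _

/-- The size of the sample as a bound in the parameters of the problem. -/
theorem sampleSize_le_mul (hν : 1 ≤ ν) (hvc : 1 ≤ vc) (hr : 1 ≤ r)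
    (hlog : (r : ℝ) ≤ Real.log n) :
    9 * (sampleSize n ν vc r a : ℝ) ≤
      (72 * (3 + a) : ℕ) * (vc * (n : ℝ) ^ ((1 : ℝ) / r) * ν) * Real.log n ^ 2 := by
  have hn := three_le_of_log hr hlog
  have h4 : (1 : ℝ) ≤ Real.log n := le_trans (by exact_mod_cast hr) hlog
  have hg := growth_le_two_mul (n := n) (r := r) (by omega)
  have hx := one_le_rpow (n := n) (r := r) (by omega)
  have h3 : ((2 * vc + 1 + a : ℕ) : ℝ) ≤ (3 + a : ℕ) * vc := by
    exact_mod_cast (by nlinarith : 2 * vc + 1 + a ≤ (3 + a) * vc)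
  have hs := sampleSize_le (vc := vc) (a := a) hν hr hlog
  have hT : ((ν * (2 * r) : ℕ) : ℝ) ≤ ν * (2 * Real.log n) := by
    push_cast
    gcongr
  -- Besides the 9, there are three factors 2: rounding in `sampleSize`, `T = 2νr`, and rounding in
  -- `growth`. One logarithm bounds `r`, the other comes from `Θ`.
  calc 9 * (sampleSize n ν vc r a : ℝ)
      ≤ 9 * (2 * (((ν * (2 * r) : ℕ) : ℝ) * growth n r *
          (((2 * vc + 1 + a : ℕ) : ℝ) * Real.log n))) := by gcongr
    _ ≤ 9 * (2 * ((ν * (2 * Real.log n)) * (2 * (n : ℝ) ^ ((1 : ℝ) / r)) *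
          (((3 + a : ℕ) * vc) * Real.log n))) := by gcongr
    _ = _ := by push_cast; ring

/-- All counters are polynomial in `n ≤ 2 ^ b`: together they cost `n ^ 18` and a constant factor.
The stored constraint adds one more `2 ^ b`, giving the 19 in `d`. -/
theorem card_state_mkParams (hν : 1 ≤ ν) (hνn : ν ≤ n) (hvcn : vc ≤ n) (hr : 1 ≤ r)
    (hlog : (r : ℝ) ≤ Real.log n) (hb : n ≤ 2 ^ b)
    (hd : d = 36 * (3 + a) + 10 + 19) :
    Fintype.card ((mkParams n ν vc r a d b).State b) ≤ 2 ^ (mkParams n ν vc r a d b).w := by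
  have hn := three_le_of_log hr hlog
  have hlogn : Real.log n ≤ n := Real.log_le_self (Nat.cast_nonneg _)
  have hrn : r ≤ n := by exact_mod_cast hlog.trans hlogn
  have hb1 : 1 ≤ b := by
    by_contra h0
    have : b = 0 := by omega
    subst this
    omega
  have hT : ν * (2 * r) ≤ 2 * n ^ 2 := by
    calc ν * (2 * r) ≤ n * (2 * n) := by gcongr
      _ = _ := by ring
  have hq : sampleSize n ν vc r a ≤ 2 * (2 * (3 + a) * n ^ 5) := by
    have h1 := sampleSize_le (vc := vc) (a := a) hν hr hlog
    have h2 : ((2 * vc + 1 + a : ℕ) : ℝ) ≤ (3 + a : ℕ) * n := by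
      exact_mod_cast (by nlinarith : 2 * vc + 1 + a ≤ (3 + a) * n)
    have h3 : (growth n r : ℝ) ≤ n := by exact_mod_cast growth_le (by omega) hr
    have h4 : ((ν * (2 * r) : ℕ) : ℝ) ≤ (2 * n ^ 2 : ℕ) := by exact_mod_cast hT
    have h5 : 2 * (((ν * (2 * r) : ℕ) : ℝ) * growth n r *
        (((2 * vc + 1 + a : ℕ) : ℝ) * Real.log n)) ≤
        2 * (((2 * n ^ 2 : ℕ) : ℝ) * n * (((3 + a : ℕ) * n : ℝ) * n)) := by
      have : 0 ≤ Real.log n := Real.log_natCast_nonneg n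
      gcongr
    have h6 : (sampleSize n ν vc r a : ℝ) ≤ ((2 * (2 * (3 + a) * n ^ 5) : ℕ) : ℝ) :=
      (h1.trans h5).trans (le_of_eq (by push_cast; ring))
    exact_mod_cast h6
  have hn1 : 1 ≤ n ^ 5 := Nat.one_le_pow _ _ (by omega)
  have hM : 9 * sampleSize n ν vc r a + 1 ≤ 2 ^ (36 * (3 + a) + 10) * n ^ 5 := by
    calc 9 * sampleSize n ν vc r a + 1 ≤ (36 * (3 + a) + 10) * n ^ 5 := by nlinarith
      _ ≤ _ := Nat.mul_le_mul_right _ Nat.lt_two_pow_self.le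
  have hT' : ν * (2 * r) + 1 ≤ n ^ 3 := by nlinarith [Nat.mul_le_mul hn (le_refl (n ^ 2))]
  have h2n : 2 * n + 1 ≤ n ^ 2 := by nlinarith
  have h7 : 7 ≤ n ^ 2 := by nlinarith
  refine (Params.card_state_le _).trans ?_
  change 7 * (2 ^ b * ((ν * (2 * r) + 1) * ((9 * sampleSize n ν vc r a + 1) * ((2 * n + 1) *
    ((ν * (2 * r) + 1) * (ν * (2 * r) + 1)))))) ≤ 2 ^ (d * b)
  calc _ ≤ n ^ 2 * (2 ^ b * (n ^ 3 * ((2 ^ (36 * (3 + a) + 10) * n ^ 5) * (n ^ 2 *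
        (n ^ 3 * n ^ 3))))) := by gcongr
    _ = 2 ^ b * 2 ^ (36 * (3 + a) + 10) * n ^ 18 := by ring
    _ ≤ 2 ^ b * 2 ^ ((36 * (3 + a) + 10) * b) * (2 ^ b) ^ 18 := by
        gcongr
        · norm_num
        · exact Nat.le_mul_of_pos_right _ hb1
    _ = 2 ^ (d * b) := by rw [hd, ← pow_mul, ← pow_add, ← pow_add]; congr 1; ring

end Parameters

/-- A problem with parameters as in `mkParams`. -/
noncomputable def mkSetting {n ν vc r a d b : ℕ} {R : Type*} [LinearOrder R]
    (f : Finset (Constraint b) → R) (S : Finset (Constraint b)) (K : Constraint b → Set R)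
    (bas : Finset (Constraint b) → Finset (Constraint b)) (stream : Fin n → Constraint b)
    (Tv : ℕ → ℕ → ℕ) (Tb : ℕ → ℕ) (hν : 1 ≤ ν) (hr : 1 ≤ r) (hlog : (r : ℝ) ≤ Real.log n)
    (hw : n ≤ 2 ^ (d * b)) (hS : S.card = n) (hK : IsMinOfInter f S K) (hdim : combDim f S ≤ ν)
    (hbas : ∀ N ⊆ S, IsBasis f N (bas N)) (hinj : Function.Injective stream)
    (hrange : Set.range stream = (S : Set (Constraint b)))
    (hTv : ∀ t t' m m', t ≤ t' → m ≤ m' → Tv t m ≤ Tv t' m') (hTb : Monotone Tb) :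
    Setting (mkParams n ν vc r a d b) b R :=
  have hn := three_le_of_log hr hlog
  have hn0 : (0 : ℝ) < n := by exact_mod_cast (by omega : 0 < n)
  have hlog1 : (1 : ℝ) ≤ Real.log n := le_trans (by exact_mod_cast hr) hlog
  have hT1 : (1 : ℝ) ≤ ((ν * (2 * r) : ℕ) : ℝ) := by
    exact_mod_cast Nat.mul_pos hν (by omega)
  have hg1 : (1 : ℝ) ≤ growth n r := by exact_mod_cast one_le_growth (by omega)
  have h31 : (1 : ℝ) ≤ ((2 * vc + 1 + a : ℕ) : ℝ) := by exact_mod_cast (by omega)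
  have hexp : ((n : ℝ) ^ (2 * vc + 1 + a)) =
      Real.exp (((2 * vc + 1 + a : ℕ) : ℝ) * Real.log n) := by
    rw [Real.exp_nat_mul, Real.exp_log hn0]
  have hle := le_sampleSize (n := n) (ν := ν) (vc := vc) (r := r) (a := a)
  have hTq : ((ν * (2 * r) : ℕ) : ℝ) ≤ sampleSize n ν vc r a := by
    refine le_trans ?_ hle
    rw [mul_assoc]
    exact le_mul_of_one_le_right (by positivity) (one_le_mul_of_one_le_of_one_le hg1
      (one_le_mul_of_one_le_of_one_le h31 hlog1))
  have hTq' : ν * (2 * r) ≤ sampleSize n ν vc r a := by exact_mod_cast hTq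
  { f := f, S := S, K := K, bas := bas, stream := stream, Tv := Tv, Tb := Tb, ν := ν, r := r
    -- The initial potential is at most `n ^ (2 * vc + 1)`, since `n + 1 ≤ n ^ 2`; the factor `n ^
    -- a` gives the failure probability. `sampleSize` is chosen to make `exp (q / (Tβ))` at least
    -- this number.
    Θ := (n : ℝ) ^ (2 * vc + 1 + a)
    card_S := hS
    isMin := hK
    combDim_le := hdim
    bas_spec := hbas
    injective := hinj
    range_eq := hrange
    Tv_mono := hTv
    Tb_mono := hTb
    three_le := hn
    one_le_ν := hν
    one_le_r := hr
    T_eq := rfl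
    le_pow := le_growth_pow hr
    one_le_β := one_le_growth (by omega)
    one_le_q := le_trans (Nat.mul_pos hν (by omega)) hTq'
    le_two_pow := hw
    ν_le := by
      change ν ≤ 9 * sampleSize n ν vc r a
      have : ν ≤ ν * (2 * r) := Nat.le_mul_of_pos_right _ (by omega)
      omega
    Θ_nonneg := by positivity
    Θ_le_exp := by
      rw [hexp, Real.exp_le_exp]
      refine (le_div_iff₀ (mul_pos (zero_lt_one.trans_le hT1) (zero_lt_one.trans_le hg1))).2 ?_
      exact le_of_eq_of_le (mul_comm _ _) hle
    Θ_le_exp' := by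
      rw [hexp, Real.exp_le_exp]
      have h1 : ((2 * vc + 1 + a : ℕ) : ℝ) * Real.log n ≤ sampleSize n ν vc r a := by
        refine le_trans ?_ hle
        exact le_mul_of_one_le_left (by positivity) (one_le_mul_of_one_le_of_one_le hT1 hg1)
      change _ ≤ ((9 * sampleSize n ν vc r a : ℕ) : ℝ) + 1 - 8 * (sampleSize n ν vc r a : ℝ)
      push_cast at h1 ⊢
      linarith }

/-- The failure probability for the threshold of `mkSetting`. -/
theorem card_exclusionFamily_add_one_le {U R : Type*} [DecidableEq U] {S : Finset U}
    {K : U → Set R} {n vc a : ℕ} {c : ℝ} (hn : 3 ≤ n) (hS : S.card = n)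
    (hvc : problemVCDim S K ≤ vc) (ha : c ≤ a) :
    ((exclusionFamily S K).card + 1 : ℝ) ≤ (n : ℝ) ^ (-c) * (n : ℝ) ^ (2 * vc + 1 + a) := by
  have hn1 : (1 : ℝ) ≤ n := by exact_mod_cast (by omega : 1 ≤ n)
  have h1 : (exclusionFamily S K).card + 1 ≤ n ^ (2 * vc + 1) := by
    have h2 : (exclusionFamily S K).card ≤ (n ^ 2) ^ vc := by
      refine (card_exclusionFamily_le S K).trans ?_
      rw [hS]
      exact (Nat.pow_le_pow_right (by omega) hvc).trans (Nat.pow_le_pow_left (by nlinarith) _)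
    rw [← pow_mul] at h2
    have h3 : 1 ≤ n ^ (2 * vc) := Nat.one_le_pow _ _ (by omega)
    rw [pow_succ]
    nlinarith
  calc ((exclusionFamily S K).card + 1 : ℝ) ≤ (n : ℝ) ^ (2 * vc + 1) := by exact_mod_cast h1
    _ ≤ ((n : ℝ) ^ (-c) * (n : ℝ) ^ a) * (n : ℝ) ^ (2 * vc + 1) := by
        refine le_mul_of_one_le_left (by positivity) ?_
        rw [← Real.rpow_natCast, ← Real.rpow_add (by linarith)]
        exact Real.one_le_rpow hn1 (by linarith)
    _ = _ := by rw [pow_add _ (2 * vc + 1) a]; ring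
theorem steps_mkParams_le {n ν vc r a d b : ℕ} (hn : 3 ≤ n) (hν : 1 ≤ ν) (hr : 1 ≤ r) :
    (mkParams n ν vc r a d b).steps ≤ 36 * (ν * r) * n := by
  change (ν * (2 * r) - 0) * (4 * n + 6) + (2 * n - 0) * (ν * (2 * r) + 2) + 4 * n + 4 ≤ _
  have hT : ν * (2 * r) = 2 * (ν * r) := by ring
  have h1 : 1 ≤ ν * r := Nat.mul_pos hν hr
  rw [hT]
  generalize ν * r = t at h1
  simp only [Nat.sub_zero]
  nlinarith [Nat.mul_le_mul h1 hn, Nat.mul_le_mul h1 (le_refl n), Nat.mul_le_mul (le_refl t) hn]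

/-! ### Assembly of the bounds -/

theorem mainTheorem5 (c : ℝ) (hc : 1 ≤ c) :
    ∃ C k : ℕ, ∀ n ν vc r b : ℕ, 1 ≤ ν → 1 ≤ r → (r : ℝ) ≤ Real.log n →
      -- the machine knows only the parameters, not the problem
      ∃ M : Machine b, M.w ≤ C * b ∧
        ∀ (R : Type*) [LinearOrder R] (f : Finset (Constraint b) → R)
          (S : Finset (Constraint b)) (K : Constraint b → Set R),
          S.card = n → IsLPType f S → IsMinOfInter f S K →
          combDim f S ≤ ν → problemVCDim S K ≤ vc →
        -- the procedure for bases, the order of the stream, and the costs of the two procedures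
        ∀ (bas : Finset (Constraint b) → Finset (Constraint b)),
          (∀ N ⊆ S, IsBasis f N (bas N)) →
        ∀ (stream : Fin n → Constraint b),
          Function.Injective stream → Set.range stream = (S : Set (Constraint b)) →
        ∀ (Tv : ℕ → ℕ → ℕ) (Tb : ℕ → ℕ),
          (∀ t t' m m', t ≤ t' → m ≤ m' → Tv t m ≤ Tv t' m') → (∀ t m, t ≤ Tv t m) →
          Monotone Tb →
        ∃ T : ℕ,
          (∀ z ∈ (M.run f bas Tv Tb stream T).support,
            (∃ A, z.Outputs A) ∧
            z.passes ≤ C * (ν * r) ∧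
            (z.peak : ℝ) ≤
              C * (vc * (n : ℝ) ^ ((1 : ℝ) / r) * ν + (ν : ℝ) ^ 2) * Real.log n ^ k * b ∧
            z.time ≤ C * (ν * r * Tv n ν +
              ν * r * Tb ⌈C * (vc * (n : ℝ) ^ ((1 : ℝ) / r) * ν) * Real.log n ^ k⌉₊)) ∧
          ENNReal.ofReal (1 - (n : ℝ) ^ (-c)) ≤
            (M.run f bas Tv Tb stream T).toOuterMeasure {z | ∃ A, z.Outputs A ∧ f A = f S} := by
  obtain ⟨a, ha⟩ : ∃ a : ℕ, c ≤ a := ⟨⌈c⌉₊, Nat.le_ceil c⟩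
  obtain ⟨d, hd⟩ : ∃ d, d = 36 * (3 + a) + 10 + 19 := ⟨_, rfl⟩
  obtain ⟨C, hC⟩ : ∃ C, C = 72 * (3 + a) + d + 50 := ⟨_, rfl⟩
  refine ⟨C, 2, fun n ν vc r b hν hr hlog => ?_⟩
  have hn := three_le_of_log hr hlog
  have hlog1 : (1 : ℝ) ≤ Real.log n := le_trans (by exact_mod_cast hr) hlog
  have hC1 : (1 : ℝ) ≤ C := by exact_mod_cast (by omega : 1 ≤ C)
  have hν1 : (1 : ℝ) ≤ ν := by exact_mod_cast hν
  -- For `vc = 0` the empty set already has the value of `S`; for `2 ^ b < n` there are not enough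
  -- strings for a problem to exist. Otherwise `n ≤ 2 ^ b`, so numbers polynomial in `n` fit into
  -- `O(b)` bits.
  by_cases htriv : vc = 0 ∨ 2 ^ b < n
  · refine ⟨haltMachine b, Nat.zero_le _, ?_⟩
    intro R _ f S K hS _ hK _ hvc bas _ stream _ _ Tv Tb _ _ _
    rcases htriv with rfl | hbn
    · have hf := hK.eq_of_problemVCDim_eq_zero (Nat.le_zero.1 hvc)
      have hout : (haltMachine b).init.Outputs ∅ := ⟨(0 : Fin 1), rfl, rfl⟩
      refine ⟨0, fun z hz => ?_, ?_⟩
      · rw [Machine.run, PMF.mem_support_pure_iff] at hz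
        subst hz
        refine ⟨⟨∅, hout⟩, Nat.zero_le _, ?_, Nat.zero_le _⟩
        have h1 : (((haltMachine b).init.peak : ℕ) : ℝ) = b := by
          simp [Machine.init, haltMachine]
        rw [h1]
        refine le_mul_of_one_le_left (Nat.cast_nonneg _) ?_
        refine one_le_mul_of_one_le_of_one_le (one_le_mul_of_one_le_of_one_le hC1 ?_)
          (one_le_pow₀ hlog1)
        simpa using hν
      · rw [Machine.run, PMF.toOuterMeasure_pure_apply, if_pos ⟨∅, hout, hf⟩]
        rw [← ENNReal.ofReal_one]
        exact ENNReal.ofReal_le_ofReal (sub_le_self _ (by positivity))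
    · have := S.card_le_univ
      rw [hS, Fintype.card_fun, Fintype.card_bool, Fintype.card_fin] at this
      omega
  · push Not at htriv
    obtain ⟨hvc0, hbn⟩ := htriv
    -- Neither dimension exceeds `n`; capping them keeps the counters polynomial in `n`.
    obtain ⟨ν', hν'⟩ : ∃ ν', ν' = min ν n := ⟨_, rfl⟩
    obtain ⟨vc', hvc'⟩ : ∃ vc', vc' = min vc n := ⟨_, rfl⟩
    have hν'1 : 1 ≤ ν' := by omega
    have hvc'1 : 1 ≤ vc' := by omega
    have hb1 : 1 ≤ b := by
      by_contra h0
      have : b = 0 := by omega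
      subst this
      omega
    have hw := card_state_mkParams (vc := vc') (a := a) (b := b) hν'1 (by omega) (by omega) hr hlog
      hbn hd
    refine ⟨(mkParams n ν' vc' r a d b).machine hw, Nat.mul_le_mul_right b (by omega), ?_⟩
    intro R _ f S K hS _ hK hdim hvc bas hbas stream hinj hrange Tv Tb hTv hTv' hTb
    have hdim' : combDim f S ≤ ν' := by
      rw [hν', le_min_iff]; exact ⟨hdim, hS ▸ combDim_le_card f S⟩
    have hvcd' : problemVCDim S K ≤ vc' := by
      rw [hvc', le_min_iff]; exact ⟨hvc, hS ▸ problemVCDim_le_card S K⟩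
    have hnw : n ≤ 2 ^ (d * b) :=
      hbn.trans (Nat.pow_le_pow_right two_pos (Nat.le_mul_of_pos_left _ (by omega)))
    have hrun := (mkSetting (vc := vc') (a := a) f S K bas stream Tv Tb hν'1 hr hlog hnw hS hK
      hdim' hbas hinj hrange hTv hTb).run_steps hw (δ := (n : ℝ) ^ (-c))
        (pow_pos (by exact_mod_cast (by omega : 0 < n)) _)
        (card_exclusionFamily_add_one_le hn hS hvcd' ha)
    refine ⟨(mkParams n ν' vc' r a d b).steps + 1, fun z hz => ?_, hrun.2⟩
    obtain ⟨hout, hfin⟩ := hrun.1 z hz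
    have hνν : ν' ≤ ν := by omega
    have hνr : ν' * r ≤ ν * r := Nat.mul_le_mul_right _ hνν
    have hνr1 : 1 ≤ ν' * r := Nat.mul_pos hν'1 hr
    have hx1 := one_le_rpow (n := n) (r := r) (by omega)
    have hM : 9 * (sampleSize n ν' vc' r a : ℝ) ≤
        (72 * (3 + a) : ℕ) * (vc * (n : ℝ) ^ ((1 : ℝ) / r) * ν) * Real.log n ^ 2 := by
      refine (sampleSize_le_mul hν'1 hvc'1 hr hlog).trans ?_
      have h1 : (ν' : ℝ) ≤ ν := by exact_mod_cast hνν
      have h2 : (vc' : ℝ) ≤ vc := by exact_mod_cast (by omega : vc' ≤ vc)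
      gcongr
    refine ⟨hout, ?_, ?_, ?_⟩
    · have h1 : z.passes ≤ ν' * (2 * r) + 1 := hfin.passes
      have h2 : ν' * (2 * r) = 2 * (ν' * r) := by ring
      have h3 : 3 * (ν * r) ≤ C * (ν * r) := Nat.mul_le_mul_right _ (by omega)
      omega
    · have h1 : z.peak ≤ d * b + b * (ν' * (2 * r) + 1 +
          (9 * sampleSize n ν' vc' r a + ν' * (2 * r) * ν')) := hfin.peak
      have h2 : (z.peak : ℝ) ≤ (d + (ν' * (2 * r) + 1 + (9 * sampleSize n ν' vc' r a +
          ν' * (2 * r) * ν')) : ℝ) * b := by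
        refine (Nat.cast_le.2 h1).trans (le_of_eq ?_)
        push_cast; ring
      refine h2.trans (mul_le_mul_of_nonneg_right ?_ (Nat.cast_nonneg _))
      set Y := (vc * (n : ℝ) ^ ((1 : ℝ) / r) * ν) with hY
      have hY0 : 0 ≤ Y := by positivity
      have hL : (1 : ℝ) ≤ Real.log n ^ 2 := one_le_pow₀ hlog1
      have hZ : (1 : ℝ) ≤ (ν : ℝ) ^ 2 := one_le_pow₀ hν1
      have hZL : (1 : ℝ) ≤ (ν : ℝ) ^ 2 * Real.log n ^ 2 := one_le_mul_of_one_le_of_one_le hZ hL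
      have hν'ν : (ν' : ℝ) ≤ ν := by exact_mod_cast hνν
      have hrL : (r : ℝ) ≤ Real.log n ^ 2 := hlog.trans (le_self_pow₀ hlog1 two_ne_zero)
      have h3 : (ν' : ℝ) * (2 * r) ≤ 2 * ((ν : ℝ) ^ 2 * Real.log n ^ 2) := by
        calc (ν' : ℝ) * (2 * r) ≤ (ν : ℝ) ^ 2 * (2 * Real.log n ^ 2) := by
              gcongr
              exact hν'ν.trans (le_self_pow₀ hν1 two_ne_zero)
          _ = _ := by ring
      have h4 : (ν' : ℝ) * (2 * r) * ν' ≤ 2 * ((ν : ℝ) ^ 2 * Real.log n ^ 2) := by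
        calc (ν' : ℝ) * (2 * r) * ν' ≤ (ν : ℝ) * (2 * Real.log n ^ 2) * ν := by gcongr
          _ = _ := by ring
      have h5 : (d : ℝ) ≤ d * ((ν : ℝ) ^ 2 * Real.log n ^ 2) :=
        le_mul_of_one_le_right (Nat.cast_nonneg _) hZL
      have hCr : (C : ℝ) = (72 * (3 + a) : ℕ) + d + 50 := by rw [hC]; push_cast; ring
      have hYL : 0 ≤ Y * Real.log n ^ 2 := by positivity
      have h6 : ((d : ℝ) + 50) * (Y * Real.log n ^ 2) ≥ 0 := by positivity
      have h7 : ((72 * (3 + a) : ℕ) : ℝ) * ((ν : ℝ) ^ 2 * Real.log n ^ 2) ≥ 0 := by positivity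
      calc _ ≤ (72 * (3 + a) : ℕ) * (Y * Real.log n ^ 2) +
            (d + 5) * ((ν : ℝ) ^ 2 * Real.log n ^ 2) := by linarith
        _ ≤ ((72 * (3 + a) : ℕ) + d + 50 : ℝ) * (Y * Real.log n ^ 2) +
            ((72 * (3 + a) : ℕ) + d + 50 : ℝ) * ((ν : ℝ) ^ 2 * Real.log n ^ 2) := by linarith
        _ = _ := by rw [hCr]; ring
    · set m := ⌈C * (vc * (n : ℝ) ^ ((1 : ℝ) / r) * ν) * Real.log n ^ 2⌉₊ with hm
      have hMm : 9 * sampleSize n ν' vc' r a ≤ m := by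
        have h1 : ((9 * sampleSize n ν' vc' r a : ℕ) : ℝ) ≤ m := by
          refine le_trans ?_ (Nat.le_ceil _)
          push_cast
          refine hM.trans ?_
          have h2 : ((72 * (3 + a) : ℕ) : ℝ) ≤ C := by exact_mod_cast (by omega)
          gcongr
        exact_mod_cast h1
      have h1 : z.time ≤ (mkParams n ν' vc' r a d b).steps + ν' * (2 * r) * Tv n ν' +
          (ν' * (2 * r) + 1) * (Tv n ν' + 2 * Tb (9 * sampleSize n ν' vc' r a)) := hfin.time
      have h2 := steps_mkParams_le (vc := vc') (a := a) (d := d) (b := b) hn hν'1 hr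
      have h3 : Tb (9 * sampleSize n ν' vc' r a) ≤ Tb m := hTb hMm
      have h4 : Tv n ν' ≤ Tv n ν := hTv _ _ _ _ le_rfl hνν
      -- This lets the `O(νrn)` machine steps be absorbed by the tests.
      have h5 : n ≤ Tv n ν := hTv' _ _
      have h6 : ν' * (2 * r) = 2 * (ν' * r) := by ring
      rw [h6] at h1
      calc z.time ≤ 36 * (ν * r) * Tv n ν + 2 * (ν * r) * Tv n ν +
            (4 * (ν * r)) * (Tv n ν + 2 * Tb m) := by
            refine h1.trans (Nat.add_le_add (Nat.add_le_add (h2.trans ?_) ?_) ?_)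
            · gcongr
            · gcongr
            · gcongr
              omega
        _ ≤ 50 * (ν * r * Tv n ν + ν * r * Tb m) := by
            rw [show ∀ x y z : ℕ, 36 * x * y + 2 * x * y + 4 * x * (y + 2 * z) =
              42 * (x * y) + 8 * (x * z) by intros; ring]
            omega
        _ ≤ _ := Nat.mul_le_mul_right _ (by omega)
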